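/- Running times are counted on a unit-cost random access machine whose memory cells hold rational numbers: arithmetic operations, rounding down, comparisons and memory accesses take one step each, and memory cells that do not hold the input have arbitrary initial contents. Precisions $\varepsilon\in(0,1)$ are rational and are part of the input, and $n\ge 1$ denotes the number of items. All knapsack instances have integral weights $w_1,\dots,w_n$ and an integral capacity $W$ with $1\le w_i\le W$ for all $i$. The ordinary knapsack problem with profits $p_i\in\mathbb{N}_0$ asks for $x\in\{0,1\}^n$ with $\sum_i w_i x_i\le W$ maximizing $\sum_i p_i x_i$. An FPTAS for it with running time $A(n,\varepsilon)$ is an algorithm that computes, for every instance with $n$ items and every $\varepsilon$, in at most $A(n,\varepsilon)$ steps a feasible solution whose profit is at least $(1-\varepsilon)$ times the maximum, where $A(n,\varepsilon)$ is bounded by a polynomial in $n$ and $1/\varepsilon$. In the parametric knapsack problem the profit of item $i$ is $a_i+\lambda b_i$ with arbitrary $a_i,b_i\in\mathbb{Z}$ and a parameter $\lambda\in\mathbb{R}$. An FPTAS for it with running time $B(n,\varepsilon)$ is an algorithm that computes, for every instance with $n$ items and every $\varepsilon$, in at most $B(n,\varepsilon)$ steps numbers $\lambda_1<\dots<\lambda_k$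 and, for each of the $k+1$ intervals $(-\infty,\lambda_1],[\lambda_1,\lambda_2],\dots,[\lambda_k,\infty)$, a feasible solution whose profit at every $\lambda$ in the interval is at least $(1-\varepsilon)\,p^*(\lambda)$, where $p^*(\lambda)$ is the maximum profit of a feasible solution at $\lambda$; again $B(n,\varepsilon)$ has to be bounded by a polynomial in $n$ and $1/\varepsilon$. **Theorem.** There is a constant $C>0$ such that for every FPTAS for the ordinary knapsack problem, with running time $A(n,\varepsilon)$, there is an FPTAS for the parametric knapsack problem that outputs at most $C\,n^2/\varepsilon$ intervals and whose running time $B(n,\varepsilon)$ satisfies $$B(n,\varepsilon)\le C\cdot\frac{n^2}{\varepsilon}\cdot A\!\left(n,\tfrac{\varepsilon}{2}\right)\qquad\text{for all } n\ge 1,\ \varepsilon\in(0,1).$$ In particular, $B(n,\varepsilon)\le C K\cdot\frac{n^2}{\varepsilon}\cdot A(n,\varepsilon)$, that is, $B(n,\varepsilon)=\mathcal{O}\big(\frac{n^2}{\varepsilon}\cdot A(n,\varepsilon)\big)$, whenever $A(n,\frac{\varepsilon}{2})\le K\cdot A(n,\varepsilon)$ for all $n$ and $\varepsilon$. Moreover,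 if $A(n,\varepsilon)=\mathcal{O}\big(n\log\frac1\varepsilon+\frac1{\varepsilon^3}\log^2\frac1\varepsilon\big)$ for $\varepsilon\le\frac12$, which is the running time reported for the FPTAS of Kellerer and Pferschy, then $B(n,\varepsilon)=\mathcal{O}\big(\frac{n^3}{\varepsilon}\log\frac1\varepsilon+\frac{n^2}{\varepsilon^4}\log^2\frac1\varepsilon\big)$ for $\varepsilon\le\frac12$. -/

import Mathlib

namespace ParamKnapsack

/-! ## Knapsack problems -/

/-- The packing constraint of a knapsack problem with items `0, …, n - 1`: positive integral weights
and an integral capacity; every single item fits into the knapsack. -/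
structure Knapsack (n : ℕ) where
  weight : Fin n → ℕ
  capacity : ℕ
  weight_pos : ∀ i, 0 < weight i
  weight_le : ∀ i, weight i ≤ capacity

/-- A solution is the set of packed items (the items `i` with `x i = 1`). It is feasible if its
total weight does not exceed the capacity. -/
def Knapsack.Feasible {n : ℕ} (K : Knapsack n) (x : Finset (Fin n)) : Prop :=
  ∑ i ∈ x, K.weight i ≤ K.capacity

instance {n : ℕ} (K : Knapsack n) : DecidablePred K.Feasible :=
  fun x => inferInstanceAs (Decidable (∑ i ∈ x, K.weight i ≤ K.capacity))

/-- The finite set of all feasible solutions. -/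
def Knapsack.solutions {n : ℕ} (K : Knapsack n) : Finset (Finset (Fin n)) :=
  Finset.univ.filter K.Feasible

theorem Knapsack.solutions_nonempty {n : ℕ} (K : Knapsack n) : K.solutions.Nonempty :=
  ⟨∅, by simp [Knapsack.solutions, Knapsack.Feasible]⟩

/-- The maximum total profit of a feasible solution, for the (possibly negative) profits `v`. -/
noncomputable def Knapsack.opt {n : ℕ} (K : Knapsack n) (v : Fin n → ℝ) : ℝ :=
  K.solutions.sup' K.solutions_nonempty (fun x => ∑ i ∈ x, v i)

/-- `x` is a `(1 - ε)`-approximate solution for the profits `v`. -/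
def Knapsack.IsApprox {n : ℕ} (K : Knapsack n) (ε : ℝ) (v : Fin n → ℝ)
    (x : Finset (Fin n)) : Prop :=
  K.Feasible x ∧ (1 - ε) * K.opt v ≤ ∑ i ∈ x, v i

/-- An instance of the ordinary knapsack problem, with non-negative integral profits. -/
structure OrdinaryInstance (n : ℕ) extends Knapsack n where
  profit : Fin n → ℕ

/-- An instance of the parametric knapsack problem: item `i` has the profit
`intercept i + t * slope i` at the parameter value `t`, with arbitrary integral coefficients. -/
structure ParametricInstance (n : ℕ) extends Knapsack n where
  intercept : Fin n → ℤ
  slope : Fin n → ℤ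

/-- The profits of the items at the parameter value `t`. -/
noncomputable def ParametricInstance.profitAt {n : ℕ} (I : ParametricInstance n) (t : ℝ) :
    Fin n → ℝ :=
  fun i => (I.intercept i : ℝ) + t * (I.slope i : ℝ)

/-- The `j`-th of the `k + 1` intervals `(-∞, l 0], [l 0, l 1], …, [l (k - 1), ∞)` into which the
numbers `l 0 < ⋯ < l (k - 1)` divide the real line, where `0 ≤ j ≤ k`. -/
def piece (k : ℕ) (l : ℕ → ℚ) (j : ℕ) : Set ℝ :=
  {t | (∀ i, i + 1 = j → (l i : ℝ) ≤ t) ∧ (j < k → t ≤ (l j : ℝ))}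

/-! ## The machine model

A unit-cost random access machine, given by its structured programs. Its memory consists of scalar
variables and of arrays, both named by natural numbers fixed in the program text; every cell
contains a rational number, and array cells are addressed by computed natural numbers. Arithmetic
operations, rounding down, comparisons, memory accesses and control transfers have unit cost. -/

/-- A memory state. -/
structure State where
  var : ℕ → ℚ
  arr : ℕ → ℕ → ℚ

/-- Overwrite a scalar variable. -/
def State.setVar (s : State) (x : ℕ) (q : ℚ) : State :=
  { s with var := Function.update s.var x q }

/-- Overwrite the cell with address `m` of the array `a`. -/
def State.setCell (s : State) (a m : ℕ) (q : ℚ) : State :=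
  { s with arr := Function.update s.arr a (Function.update (s.arr a) m q) }

/-- Arithmetic expressions. -/
inductive Expr : Type where
  | const (q : ℚ) : Expr
  | var (x : ℕ) : Expr
  | get (a : ℕ) (i : Expr) : Expr
  | add (e f : Expr) : Expr
  | sub (e f : Expr) : Expr
  | mul (e f : Expr) : Expr
  | div (e f : Expr) : Expr
  | floor (e : Expr) : Expr

/-- The value of an expression. A number `q` used as an address stands for the natural number
`⌊q⌋₊`, and division by zero yields zero. -/
def Expr.eval (s : State) : Expr → ℚ
  | .const q => q
  | .var x => s.var x
  | .get a i => s.arr a ⌊i.eval s⌋₊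
  | .add e f => e.eval s + f.eval s
  | .sub e f => e.eval s - f.eval s
  | .mul e f => e.eval s * f.eval s
  | .div e f => e.eval s / f.eval s
  | .floor e => (⌊e.eval s⌋ : ℚ)

/-- The number of elementary operations that the evaluation of an expression takes. -/
def Expr.cost : Expr → ℕ
  | .const _ => 1
  | .var _ => 1
  | .get _ i => i.cost + 1
  | .add e f => e.cost + f.cost + 1
  | .sub e f => e.cost + f.cost + 1
  | .mul e f => e.cost + f.cost + 1
  | .div e f => e.cost + f.cost + 1
  | .floor e => e.cost + 1

/-- Programs. `ifLt e f c d` executes `c` if the value of `e` is less than that of `f`, and `d`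
otherwise; `whileLt e f c` repeats `c` as long as the value of `e` is less than that of `f`. -/
inductive Prog : Type where
  | skip : Prog
  | assign (x : ℕ) (e : Expr) : Prog
  | store (a : ℕ) (i e : Expr) : Prog
  | seq (c d : Prog) : Prog
  | ifLt (e f : Expr) (c d : Prog) : Prog
  | whileLt (e f : Expr) (c : Prog) : Prog

/-- `Exec c s t s'`: started in the state `s`, the program `c` halts after exactly `t` elementary
steps in the state `s'`. -/
inductive Exec : Prog → State → ℕ → State → Prop where
  | skip (s : State) : Exec .skip s 1 s
  | assign (x : ℕ) (e : Expr) (s : State) :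
      Exec (.assign x e) s (e.cost + 1) (s.setVar x (e.eval s))
  | store (a : ℕ) (i e : Expr) (s : State) :
      Exec (.store a i e) s (i.cost + e.cost + 1) (s.setCell a ⌊i.eval s⌋₊ (e.eval s))
  | seq {c d : Prog} {s s₁ s₂ : State} {t₁ t₂ : ℕ} :
      Exec c s t₁ s₁ → Exec d s₁ t₂ s₂ → Exec (.seq c d) s (t₁ + t₂) s₂
  | ifTrue {e f : Expr} {c d : Prog} {s s' : State} {t : ℕ} :
      e.eval s < f.eval s → Exec c s t s' →
        Exec (.ifLt e f c d) s (e.cost + f.cost + 1 + t) s'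
  | ifFalse {e f : Expr} {c d : Prog} {s s' : State} {t : ℕ} :
      ¬ e.eval s < f.eval s → Exec d s t s' →
        Exec (.ifLt e f c d) s (e.cost + f.cost + 1 + t) s'
  | whileTrue {e f : Expr} {c : Prog} {s s₁ s₂ : State} {t₁ t₂ : ℕ} :
      e.eval s < f.eval s → Exec c s t₁ s₁ → Exec (.whileLt e f c) s₁ t₂ s₂ →
        Exec (.whileLt e f c) s (e.cost + f.cost + 1 + t₁ + t₂) s₂
  | whileFalse {e f : Expr} {c : Prog} {s : State} :
      ¬ e.eval s < f.eval s → Exec (.whileLt e f c) s (e.cost + f.cost + 1) s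

/-! ## Input and output

The input is stored at fixed places of the memory; all other cells have arbitrary contents. -/

/-- The memory contains the number of items, the packing constraint and the precision: `n`, the
capacity and `ε` in the variables `0`, `1`, `2`, and the weights in the array `0`. -/
def LoadsCommon {n : ℕ} (K : Knapsack n) (ε : ℚ) (s : State) : Prop :=
  s.var 0 = n ∧ s.var 1 = K.capacity ∧ s.var 2 = ε ∧ ∀ i : Fin n, s.arr 0 i = K.weight i

/-- An input of the ordinary problem; the profits are in the array `1`. -/
def LoadsOrdinary {n : ℕ} (I : OrdinaryInstance n) (ε : ℚ) (s : State) : Prop :=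
  LoadsCommon I.toKnapsack ε s ∧ ∀ i : Fin n, s.arr 1 i = I.profit i

/-- An input of the parametric problem; the intercepts are in the array `1` and the slopes in the
array `2`. -/
def LoadsParametric {n : ℕ} (I : ParametricInstance n) (ε : ℚ) (s : State) : Prop :=
  LoadsCommon I.toKnapsack ε s ∧
    (∀ i : Fin n, s.arr 1 i = I.intercept i) ∧ ∀ i : Fin n, s.arr 2 i = I.slope i

/-- The `n` cells of `u` from the address `m` on contain the 0-1-vector of the solution `x`. -/
def StoresSolution {n : ℕ} (u : ℕ → ℚ) (m : ℕ) (x : Finset (Fin n)) : Prop :=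
  ∀ i : Fin n, u (m + i) = if i ∈ x then 1 else 0

/-- The output of an algorithm for the ordinary problem: a `(1 - ε)`-approximate solution, in the
array `2`. -/
def OutputsOrdinary {n : ℕ} (I : OrdinaryInstance n) (ε : ℚ) (s : State) : Prop :=
  ∃ x : Finset (Fin n), StoresSolution (s.arr 2) 0 x ∧
    I.toKnapsack.IsApprox ε (fun i => (I.profit i : ℝ)) x

/-- The output of an algorithm for the parametric problem: a division of the real line into `k + 1`
intervals, and for each of them a solution that is `(1 - ε)`-approximate for all parameter values
in the interval. The number `k` is in the variable `3`, the increasing list of the `k` endpoints in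
the array `3`, and the `k + 1` solutions one after the other in the array `4`. -/
def OutputsParametric {n : ℕ} (I : ParametricInstance n) (ε : ℚ) (k : ℕ) (s : State) : Prop :=
  s.var 3 = k ∧
    (∀ i j, i < j → j < k → s.arr 3 i < s.arr 3 j) ∧
    ∀ j ≤ k, ∃ x : Finset (Fin n), StoresSolution (s.arr 4) (j * n) x ∧
      ∀ t ∈ piece k (s.arr 3) j, I.toKnapsack.IsApprox ε (I.profitAt t) x

/-! ## Approximation schemes -/

/-- `A n ε` is bounded by a polynomial in `n` and `1 / ε`. -/
def PolyBounded (A : ℕ → ℚ → ℝ) : Prop :=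
  ∃ d : ℕ, ∀ (n : ℕ) (ε : ℚ), 1 ≤ n → 0 < ε → ε < 1 → A n ε ≤ d * ((n : ℝ) / ε) ^ d

/-- The program `P` is a fully polynomial-time approximation scheme for the ordinary knapsack
problem with running time (at most) `A n ε`. -/
def IsOrdinaryFPTAS (P : Prog) (A : ℕ → ℚ → ℝ) : Prop :=
  PolyBounded A ∧
    ∀ (n : ℕ) (I : OrdinaryInstance n) (ε : ℚ) (s : State), 1 ≤ n → 0 < ε → ε < 1 →
      LoadsOrdinary I ε s →
        ∃ (t : ℕ) (s' : State), Exec P s t s' ∧ (t : ℝ) ≤ A n ε ∧ OutputsOrdinary I ε s'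

/-- The program `Q` is a fully polynomial-time approximation scheme for the parametric knapsack
problem with running time (at most) `B n ε` that outputs at most `N n ε` intervals. -/
def IsParametricFPTAS (Q : Prog) (B N : ℕ → ℚ → ℝ) : Prop :=
  PolyBounded B ∧
    ∀ (n : ℕ) (I : ParametricInstance n) (ε : ℚ) (s : State), 1 ≤ n → 0 < ε → ε < 1 →
      LoadsParametric I ε s →
        ∃ (t : ℕ) (s' : State) (k : ℕ), Exec Q s t s' ∧ (t : ℝ) ≤ B n ε ∧
          ((k : ℝ) + 1 ≤ N n ε) ∧ OutputsParametric I ε k s'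

end ParamKnapsack

/-! Sweep the parameter from left to right. At a sample point `s` let M be the larger of zero and
the greatest item profit, attained by an affine function of the parameter. Round the profits v_i
down to multiples of M/N, where N = ⌊2n/ε⌋ + 1, and give the resulting integers q_i ≤ N (zero for
negative profits) to the ordinary algorithm with precision ε/2. From its answer discard the items
with q_i = 0, since their true profits may be negative. The item attaining M fits on its own, so the
rounded optimum is at least N; rounding costs at most n ≤ (ε/2)N units, and the total relative error
stays below ε (`Knapsack.IsApprox.of_rounded`).

This argument uses only M ≥ 0, N v_i ≤ (q_i + 1) M, and q_i M ≤ N v_i when q_i > 0. With M continued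
affinely, each of these says that an affine function with integral coefficients, an event, is
nonnegative. The solution therefore stays good until the first event turns negative, and the root of
that event is the next breakpoint (`IsTop.isApprox`, `IsRate.nonneg_of_pos`).

Several functions may vanish at a breakpoint, so the next sample point is taken slightly to its
right. If H bounds all coefficients, a function not vanishing at the breakpoint has absolute value
at least 1/H there (`root_separation`), and a step of 1/(2H²) crosses no further root. The new point
is generic, and what is nonnegative there is nonnegative all the way back to the breakpoint
(`generic_next`, `dominates_next`).

For each item i and each 1 ≤ k ≤ N, the parameters at which the rounded profit of i is at least k
form an interval. Consecutive sample points are separated by such an interval (`IsEvent.separated`),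
and each interval is entered and left at most once. Hence there are at most 2nN = O(n²/ε)
breakpoints (`card_separated_le`). A step costs O(n) plus one call of the given algorithm, and O(n)
is absorbed because that algorithm must write n output cells (`IsOrdinaryFPTAS.le_time`). What
remains is the verification of a program that carries this out. -/

namespace ParamKnapsack

/-! ## Reasoning about programs -/

/-- All variables and arrays that the program writes to have smaller names. -/
def Prog.writeBound : Prog → ℕ
  | .skip => 0
  | .assign x _ => x + 1
  | .store a _ _ => a + 1
  | .seq c d => max c.writeBound d.writeBound
  | .ifLt _ _ c d => max c.writeBound d.writeBound
  | .whileLt _ _ c => c.writeBound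

@[simp] theorem State.setVar_var (s : State) (x y : ℕ) (q : ℚ) :
    (s.setVar x q).var y = if y = x then q else s.var y := by
  simp [State.setVar, Function.update_apply]

@[simp] theorem State.setVar_arr (s : State) (x : ℕ) (q : ℚ) : (s.setVar x q).arr = s.arr := rfl

@[simp] theorem State.setCell_var (s : State) (a m : ℕ) (q : ℚ) : (s.setCell a m q).var = s.var :=
  rfl

theorem State.setCell_arr (s : State) (a m b : ℕ) (q : ℚ) :
    (s.setCell a m q).arr b = if b = a then Function.update (s.arr a) m q else s.arr b := by
  simp [State.setCell, Function.update_apply]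

@[simp] theorem State.setCell_arr_same (s : State) (a m : ℕ) (q : ℚ) :
    (s.setCell a m q).arr a = Function.update (s.arr a) m q := by
  simp [State.setCell_arr]

/-- This is what lets the sweep keep its data across calls of an unknown program: that data lives
under names beyond the write bound. -/
theorem Exec.frame {c : Prog} {s s' : State} {t : ℕ} (h : Exec c s t s') :
    ∀ {R : ℕ}, c.writeBound ≤ R → ∀ x, R ≤ x → s'.var x = s.var x ∧ s'.arr x = s.arr x := by
  induction h with
  | skip s => intros; simp
  | assign x e s =>
    intro R hR y hy
    have : y ≠ x := by simp [Prog.writeBound] at hR; omega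
    simp [this]
  | store a i e s =>
    intro R hR y hy
    have : y ≠ a := by simp [Prog.writeBound] at hR; omega
    simp [this, State.setCell_arr]
  | seq _ _ ih₁ ih₂ =>
    intro R hR y hy
    simp only [Prog.writeBound, max_le_iff] at hR
    obtain ⟨h₁, h₂⟩ := ih₁ hR.1 y hy
    obtain ⟨h₃, h₄⟩ := ih₂ hR.2 y hy
    exact ⟨h₃.trans h₁, h₄.trans h₂⟩
  | ifTrue _ _ ih =>
    intro R hR y hy
    simp only [Prog.writeBound, max_le_iff] at hR
    exact ih hR.1 y hy
  | ifFalse _ _ ih =>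
    intro R hR y hy
    simp only [Prog.writeBound, max_le_iff] at hR
    exact ih hR.2 y hy
  | whileTrue _ _ _ ih₁ ih₂ =>
    intro R hR y hy
    obtain ⟨h₁, h₂⟩ := ih₁ hR y hy
    obtain ⟨h₃, h₄⟩ := ih₂ hR y hy
    exact ⟨h₃.trans h₁, h₄.trans h₂⟩
  | whileFalse _ => intros; simp

/-- A computation changes at most as many cells of an array as it has steps. -/
theorem Exec.changed_cells {c : Prog} {s s' : State} {t : ℕ} (h : Exec c s t s') (b : ℕ) :
    ∃ F : Finset ℕ, F.card ≤ t ∧ ∀ m, m ∉ F → s'.arr b m = s.arr b m := by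
  induction h with
  | skip s => exact ⟨∅, by simp, by simp⟩
  | assign x e s => exact ⟨∅, by simp, by simp⟩
  | store a i e s =>
    refine ⟨{⌊i.eval s⌋₊}, by simp, fun m hm => ?_⟩
    rw [State.setCell_arr]
    split_ifs with h
    · subst h
      rw [Function.update_of_ne (by simpa using hm)]
    · rfl
  | seq _ _ ih₁ ih₂ =>
    obtain ⟨F, hF, h⟩ := ih₁
    obtain ⟨G, hG, h'⟩ := ih₂
    refine ⟨F ∪ G, (Finset.card_union_le _ _).trans (by omega), fun m hm => ?_⟩
    simp only [Finset.mem_union, not_or] at hm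
    rw [h' m hm.2, h m hm.1]
  | ifTrue _ _ ih =>
    obtain ⟨F, hF, h⟩ := ih
    exact ⟨F, by omega, h⟩
  | ifFalse _ _ ih =>
    obtain ⟨F, hF, h⟩ := ih
    exact ⟨F, by omega, h⟩
  | whileTrue _ _ _ ih₁ ih₂ =>
    obtain ⟨F, hF, h⟩ := ih₁
    obtain ⟨G, hG, h'⟩ := ih₂
    refine ⟨F ∪ G, (Finset.card_union_le _ _).trans (by omega), fun m hm => ?_⟩
    simp only [Finset.mem_union, not_or] at hm
    rw [h' m hm.2, h m hm.1]
  | whileFalse _ => exact ⟨∅, by simp, by simp⟩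

/-- An algorithm for the ordinary knapsack problem takes at least `n` steps, since it has to write
the `n` cells of its output. -/
theorem IsOrdinaryFPTAS.le_time {P : Prog} {A : ℕ → ℚ → ℝ} (h : IsOrdinaryFPTAS P A) {n : ℕ}
    {ε : ℚ} (hn : 1 ≤ n) (h₀ : 0 < ε) (h₁ : ε < 1) : (n : ℝ) ≤ A n ε := by
  let I : OrdinaryInstance n :=
    { weight := fun _ => 1, capacity := 1, weight_pos := by simp, weight_le := by simp
      profit := fun _ => 0 }
  -- The output array starts with the value 2, which is not a legal output, so each of its first n
  -- cells has to change.
  let s : State :=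
    { var := fun x => if x = 0 then (n : ℚ) else if x = 1 then 1 else ε
      arr := fun a _ => if a = 0 then 1 else if a = 1 then 0 else 2 }
  obtain ⟨t, s', hex, ht, x, hx, -⟩ := h.2 n I ε s hn h₀ h₁
    ⟨⟨by simp [s], by simp [s, I], by simp [s], by simp [s, I]⟩, by simp [s, I]⟩
  obtain ⟨F, hF, hF'⟩ := hex.changed_cells 2
  have hsub : Finset.range n ⊆ F := by
    intro m hm
    by_contra hmF
    have h₂ := hF' m hmF
    have h₃ := hx ⟨m, Finset.mem_range.1 hm⟩
    simp only [zero_add] at h₃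
    rw [h₃] at h₂
    have h₄ : s.arr 2 m = 2 := by simp [s]
    rw [h₄] at h₂
    split_ifs at h₂
    · norm_num at h₂
    · norm_num at h₂
  have := Finset.card_le_card hsub
  rw [Finset.card_range] at this
  exact le_trans (by exact_mod_cast this.trans hF) ht

/-- Started in `s`, the program halts after at most `T` steps in a state that satisfies `Q`. -/
def Runs (c : Prog) (s : State) (T : ℕ) (Q : State → Prop) : Prop :=
  ∃ (t : ℕ) (s' : State), Exec c s t s' ∧ t ≤ T ∧ Q s'

theorem Runs.mono {c : Prog} {s : State} {T T' : ℕ} {Q Q' : State → Prop} (h : Runs c s T Q)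
    (hT : T ≤ T') (hQ : ∀ s', Q s' → Q' s') : Runs c s T' Q' := by
  obtain ⟨t, s', h₁, h₂, h₃⟩ := h
  exact ⟨t, s', h₁, h₂.trans hT, hQ _ h₃⟩

theorem Runs.seq {c d : Prog} {s : State} {T₁ T₂ : ℕ} {Q R : State → Prop} (h : Runs c s T₁ R)
    (h' : ∀ s', R s' → Runs d s' T₂ Q) : Runs (.seq c d) s (T₁ + T₂) Q := by
  obtain ⟨t, s', h₁, h₂, h₃⟩ := h
  obtain ⟨t', s'', h₄, h₅, h₆⟩ := h' s' h₃
  exact ⟨t + t', s'', h₁.seq h₄, by omega, h₆⟩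

/-- The weakest precondition of a program without loops. -/
def Prog.pre : Prog → (State → Prop) → State → Prop
  | .skip, Q, s => Q s
  | .assign x e, Q, s => Q (s.setVar x (e.eval s))
  | .store a i e, Q, s => Q (s.setCell a ⌊i.eval s⌋₊ (e.eval s))
  | .seq c d, Q, s => c.pre (d.pre Q) s
  | .ifLt e f c d, Q, s => (e.eval s < f.eval s → c.pre Q s) ∧ (¬ e.eval s < f.eval s → d.pre Q s)
  | .whileLt _ _ _, _, _ => False

/-- A bound for the running time of a program without loops. -/
def Prog.size : Prog → ℕ
  | .skip => 1
  | .assign _ e => e.cost + 1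
  | .store _ i e => i.cost + e.cost + 1
  | .seq c d => c.size + d.size
  | .ifLt e f c d => e.cost + f.cost + 1 + (c.size + d.size)
  | .whileLt _ _ _ => 0

theorem Prog.runs_of_pre (c : Prog) {Q : State → Prop} {s : State} {T : ℕ} (hT : c.size ≤ T)
    (h : c.pre Q s) : Runs c s T Q := by
  suffices Runs c s c.size Q from this.mono hT fun _ => id
  clear hT
  induction c generalizing Q s with
  | skip => exact ⟨_, _, .skip s, le_rfl, h⟩
  | assign x e => exact ⟨_, _, .assign x e s, le_rfl, h⟩
  | store a i e => exact ⟨_, _, .store a i e s, le_rfl, h⟩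
  | seq c d ih₁ ih₂ => exact (ih₁ h).seq fun s' h' => ih₂ h'
  | ifLt e f c d ih₁ ih₂ =>
    by_cases hlt : e.eval s < f.eval s
    · obtain ⟨t, s', h₁, h₂, h₃⟩ := ih₁ (h.1 hlt)
      exact ⟨_, s', .ifTrue hlt h₁, by simp only [Prog.size]; omega, h₃⟩
    · obtain ⟨t, s', h₁, h₂, h₃⟩ := ih₂ (h.2 hlt)
      exact ⟨_, s', .ifFalse hlt h₁, by simp only [Prog.size]; omega, h₃⟩
  | whileLt => exact h.elim

/-- A loop whose number of iterations is bounded by `N - j`. -/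
theorem Runs.whileLt {e f : Expr} {c : Prog} {T : ℕ} {Inv : ℕ → State → Prop} {Q : State → Prop}
    {N : ℕ} (hb : ∀ j s, Inv j s → e.eval s < f.eval s ∧ j < N)
    (hc : ∀ j s, Inv j s → Runs c s T fun s' => Inv (j + 1) s' ∨ ¬ e.eval s' < f.eval s' ∧ Q s')
    (m j : ℕ) (s : State) (hm : N ≤ j + m)
    (h : Inv j s ∨ ¬ e.eval s < f.eval s ∧ Q s) :
    Runs (.whileLt e f c) s (m * (e.cost + f.cost + 1 + T) + (e.cost + f.cost + 1)) Q := by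
  induction m generalizing j s with
  -- Here `m` is the remaining fuel; without any, the invariant would give j < N ≤ j.
  | zero =>
    obtain h | ⟨h, hQ⟩ := h
    · have := hb j s h; omega
    · exact ⟨_, s, .whileFalse h, by omega, hQ⟩
  | succ m ih =>
    obtain h | ⟨h, hQ⟩ := h
    · obtain ⟨t, s', h₁, h₂, h₃⟩ := hc j s h
      obtain ⟨t', s'', h₄, h₅, h₆⟩ := ih (j + 1) s' (by omega) h₃
      refine ⟨_, s'', .whileTrue (hb j s h).1 h₁ h₄, ?_, h₆⟩
      rw [Nat.succ_mul]
      omega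
    · exact ⟨_, s, .whileFalse h, by omega, hQ⟩

/-- A counting loop. -/
theorem Runs.count {x : ℕ} {f : Expr} {c : Prog} {T : ℕ} {Inv : ℕ → State → Prop} {N : ℕ}
    (hx : ∀ j s, Inv j s → s.var x = j ∧ f.eval s = N)
    (hc : ∀ j s, j < N → Inv j s → Runs c s T (Inv (j + 1))) {s : State} (h : Inv 0 s) :
    Runs (.whileLt (.var x) f c) s (N * (f.cost + 2 + T) + (f.cost + 2)) (Inv N) := by
  have test : ∀ j s, Inv j s → ((Expr.var x).eval s < f.eval s ↔ j < N) := by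
    intro j s hs
    obtain ⟨h₁, h₂⟩ := hx j s hs
    simp [Expr.eval, h₁, h₂]
  refine (Runs.whileLt (Inv := fun j s => j < N ∧ Inv j s) (Q := Inv N) (N := N) (T := T)
    (fun j s hs => ⟨(test j s hs.2).2 hs.1, hs.1⟩) (fun j s hs => ?_) N 0 s (by omega) ?_).mono
    (by simp only [Expr.cost]; apply le_of_eq; ring) fun _ => id
  · refine (hc j s hs.1 hs.2).mono le_rfl fun s' h' => ?_
    by_cases hj : j + 1 < N
    · exact Or.inl ⟨hj, h'⟩
    · refine Or.inr ⟨by rw [test _ _ h']; exact hj, ?_⟩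
      have : j + 1 = N := by omega
      rwa [this] at h'
  · by_cases hN : 0 < N
    · exact Or.inl ⟨hN, h⟩
    · refine Or.inr ⟨by rw [test _ _ h]; exact hN, ?_⟩
      have : N = 0 := by omega
      rwa [this]

/-! ## Rounded profits -/

theorem Knapsack.sum_le_opt {n : ℕ} (K : Knapsack n) (v : Fin n → ℝ) {x : Finset (Fin n)}
    (hx : K.Feasible x) : ∑ i ∈ x, v i ≤ K.opt v :=
  Finset.le_sup' (fun x => ∑ i ∈ x, v i) (by simpa [Knapsack.solutions] using hx)

theorem Knapsack.exists_opt {n : ℕ} (K : Knapsack n) (v : Fin n → ℝ) :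
    ∃ x, K.Feasible x ∧ K.opt v = ∑ i ∈ x, v i := by
  obtain ⟨x, hx, h⟩ := Finset.exists_mem_eq_sup' K.solutions_nonempty (fun x => ∑ i ∈ x, v i)
  exact ⟨x, by simpa [Knapsack.solutions] using hx, h⟩

theorem Knapsack.Feasible.subset {n : ℕ} {K : Knapsack n} {x y : Finset (Fin n)}
    (hx : K.Feasible x) (h : y ⊆ x) : K.Feasible y :=
  (Finset.sum_le_sum_of_subset h).trans hx

/-- An approximate solution for the profits `q`, which arise from the profits `v` by rounding down
to multiples of `M / N`, is an approximate solution for `v`. -/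
theorem Knapsack.IsApprox.of_rounded {n : ℕ} {K : Knapsack n} {ε : ℝ} (h₀ : 0 < ε) (h₁ : ε < 1)
    {v : Fin n → ℝ} {M : ℝ} {N : ℕ} {q : Fin n → ℕ} (hN : 0 < N) (hnN : 2 * n ≤ ε * N)
    (hM : 0 ≤ M) (hup : ∀ i, N * v i ≤ (q i + 1) * M) (hlo : ∀ i, 0 < q i → q i * M ≤ N * v i)
    (htop : M = 0 ∨ ∃ m, N ≤ q m) {x : Finset (Fin n)}
    (hx : K.IsApprox (ε / 2) (fun i => (q i : ℝ)) x) :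
    K.IsApprox ε v (x.filter fun i => 0 < q i) := by
  refine ⟨hx.1.subset (Finset.filter_subset _ _), ?_⟩
  set O := K.opt fun i => (q i : ℝ) with hO
  have hNR : (0 : ℝ) < N := by exact_mod_cast hN
  have hq : ∑ i ∈ x.filter (fun i => 0 < q i), (q i : ℝ) = ∑ i ∈ x, (q i : ℝ) := by
    apply Finset.sum_filter_of_ne
    intro i _ hi
    exact Nat.pos_of_ne_zero fun h => hi (by simp [h])
  -- Dropping items of rounded profit zero keeps the rounded value, and the lower bound `hlo` holds
  -- for all remaining items.
  have hval : (1 - ε / 2) * O * M ≤ N * ∑ i ∈ x.filter (fun i => 0 < q i), v i := by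
    calc (1 - ε / 2) * O * M ≤ (∑ i ∈ x, (q i : ℝ)) * M :=
          mul_le_mul_of_nonneg_right hx.2 hM
      _ = ∑ i ∈ x.filter (fun i => 0 < q i), (q i : ℝ) * M := by rw [← hq, Finset.sum_mul]
      _ ≤ ∑ i ∈ x.filter (fun i => 0 < q i), N * v i :=
          Finset.sum_le_sum fun i hi => hlo i (Finset.mem_filter.1 hi).2
      _ = _ := by rw [Finset.mul_sum]
  obtain ⟨y, hy, hyv⟩ := K.exists_opt v
  have hopt : N * K.opt v ≤ (O + n) * M := by
    calc N * K.opt v = ∑ i ∈ y, N * v i := by rw [hyv, Finset.mul_sum]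
      _ ≤ ∑ i ∈ y, ((q i : ℝ) + 1) * M := Finset.sum_le_sum fun i _ => hup i
      _ = (∑ i ∈ y, (q i : ℝ) + y.card) * M := by
          rw [← Finset.sum_mul, Finset.sum_add_distrib]; simp
      _ ≤ (O + n) * M := by
          refine mul_le_mul_of_nonneg_right (add_le_add (K.sum_le_opt _ hy) ?_) hM
          exact_mod_cast (Finset.card_le_univ y).trans (by simp)
  -- The item `m` alone is feasible, so O ≥ N, and `hnN` turns the rounding loss of n units into a
  -- relative loss of ε/2.
  have hlow : n * M ≤ ε / 2 * O * M := by
    obtain h | ⟨m, hm⟩ := htop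
    · simp [h]
    · have : (N : ℝ) ≤ O := by
        have h₂ := K.sum_le_opt (fun i => (q i : ℝ)) (x := {m}) (by
          simpa [Knapsack.Feasible] using K.weight_le m)
        simp only [Finset.sum_singleton] at h₂
        exact le_trans (by exact_mod_cast hm) h₂
      apply mul_le_mul_of_nonneg_right _ hM
      nlinarith
  have hOM : 0 ≤ O * M := by
    refine mul_nonneg ?_ hM
    have := K.sum_le_opt (fun i => (q i : ℝ)) (x := ∅) (by simp [Knapsack.Feasible])
    simpa using this
  refine le_of_mul_le_mul_left ?_ hNR
  calc N * ((1 - ε) * K.opt v) = (1 - ε) * (N * K.opt v) := by ring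
    _ ≤ (1 - ε) * ((O + n) * M) := mul_le_mul_of_nonneg_left hopt (by linarith)
    _ ≤ (1 - ε) * ((1 + ε / 2) * (O * M)) := mul_le_mul_of_nonneg_left (by linarith) (by linarith)
    -- (1 - ε)(1 + ε/2) = 1 - ε/2 - ε²/2.
    _ ≤ (1 - ε / 2) * O * M := by nlinarith [mul_nonneg hOM (mul_nonneg h₀.le h₀.le)]
    _ ≤ _ := hval

/-! ## Points in general position -/

/-- No nonzero affine function whose integral coefficients are at most `H` vanishes at `s`. -/
def Generic (H : ℤ) (s : ℚ) : Prop :=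
  ∀ α β : ℤ, |α| ≤ H → |β| ≤ H → (α : ℚ) + s * β = 0 → α = 0 ∧ β = 0

/-- Every affine function whose integral coefficients are at most `H` and that is nonnegative at
`s` is nonnegative at all points of `S`. -/
def Dominates (H : ℤ) (s : ℚ) (S : Set ℝ) : Prop :=
  ∀ α β : ℤ, |α| ≤ H → |β| ≤ H → 0 ≤ (α : ℚ) + s * β → ∀ t ∈ S, 0 ≤ (α : ℝ) + t * β

/-- A root -α/β has absolute value at most H, so the starting point lies to the left of all roots.
-/
theorem generic_start {H : ℤ} : Generic H (-(H + 1)) := by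
  intro α β hα hβ h
  have h' : α = (H + 1) * β := by
    have : (α : ℚ) = (H + 1) * β := by linarith
    exact_mod_cast this
  have hβ0 : β = 0 := by
    by_contra hne
    have h₁ : 1 ≤ |β| := Int.one_le_abs hne
    have h₂ : |α| = |H + 1| * |β| := by rw [h', abs_mul]
    have h₃ : 0 ≤ H := (abs_nonneg α).trans hα
    rw [abs_of_pos (by omega : 0 < H + 1)] at h₂
    nlinarith
  simp [hβ0] at h'
  exact ⟨h', hβ0⟩

/-- To the left of all roots, nonnegativity forces a slope β ≤ 0, and then the function only grows
further to the left. -/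
theorem dominates_start {H : ℤ} : Dominates H (-(H + 1)) {t | t ≤ ((-(H + 1) : ℚ) : ℝ)} := by
  intro α β hα hβ h t ht
  have h₃ : 0 ≤ H := (abs_nonneg α).trans hα
  have h' : 0 ≤ α - (H + 1) * β := by
    have : (0 : ℚ) ≤ α - (H + 1) * β := by linarith
    exact_mod_cast this
  have hβ0 : β ≤ 0 := by
    by_contra hne
    have := le_abs_self α
    nlinarith
  have hβR : (β : ℝ) ≤ 0 := by exact_mod_cast hβ0
  have h'' : (0 : ℝ) ≤ α - (H + 1) * β := by exact_mod_cast h'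
  simp only [Set.mem_ofPred_eq, Rat.cast_neg, Rat.cast_add, Rat.cast_intCast, Rat.cast_one] at ht
  nlinarith

/-- At a root of an affine function with small integral coefficients, every other such function
vanishes or is at least `1 / H` in absolute value. -/
theorem root_separation {H α₀ β₀ α β : ℤ} {l : ℚ} (hβ₀ : |β₀| ≤ H) (hne : β₀ ≠ 0)
    (hl : (α₀ : ℚ) + l * β₀ = 0) :
    (α : ℚ) + l * β = 0 ∨ 1 ≤ H * |(α : ℚ) + l * β| := by
  by_cases h : (α : ℚ) + l * β = 0
  · exact Or.inl h
  · right
    have hneQ : (β₀ : ℚ) ≠ 0 := by exact_mod_cast hne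
    -- Multiplication by β₀ clears the denominator of the root: the value becomes a nonzero integer,
    -- so it is at least 1/|β₀| ≥ 1/H in absolute value.
    have hz : ((α * β₀ - α₀ * β : ℤ) : ℚ) = β₀ * (α + l * β) := by
      push_cast
      linear_combination (-(β : ℚ)) * hl
    have hz0 : α * β₀ - α₀ * β ≠ 0 := by
      intro h0
      rw [h0] at hz
      simp only [Int.cast_zero] at hz
      exact (mul_ne_zero hneQ h) hz.symm
    have h1 : (1 : ℚ) ≤ |((α * β₀ - α₀ * β : ℤ) : ℚ)| := by
      exact_mod_cast Int.one_le_abs hz0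
    rw [hz, abs_mul] at h1
    refine h1.trans (mul_le_mul_of_nonneg_right ?_ (abs_nonneg _))
    exact_mod_cast hβ₀

/-- Over the step 1/(2H²) a function changes by at most 1/(2H), half of the gap in
`root_separation`. -/
theorem abs_mul_step {H β : ℤ} (hH : 0 < H) (hβ : |β| ≤ H) :
    H * |(1 / (2 * H ^ 2) : ℚ) * β| ≤ 1 / 2 := by
  have hHQ : (0 : ℚ) < H := by exact_mod_cast hH
  have hβQ : |(β : ℚ)| ≤ H := by exact_mod_cast hβ
  rw [abs_mul, abs_of_pos (by positivity)]
  calc (H : ℚ) * (1 / (2 * H ^ 2) * |(β : ℚ)|) ≤ H * (1 / (2 * H ^ 2) * H) := by gcongr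
    _ = 1 / 2 := by field_simp

/-- A function vanishing at the new point is too small at `l` to be nonzero there; having two zeros,
it is trivial. -/
theorem generic_next {H α₀ β₀ : ℤ} {l : ℚ} (hβ₀ : |β₀| ≤ H) (hne : β₀ ≠ 0)
    (hl : (α₀ : ℚ) + l * β₀ = 0) : Generic H (l + 1 / (2 * H ^ 2)) := by
  intro α β hα hβ h
  have hH : 0 < H := (abs_pos.2 hne).trans_le hβ₀
  have hHQ : (0 : ℚ) < H := by exact_mod_cast hH
  have hstep := abs_mul_step hH hβ
  have heq : (1 / (2 * H ^ 2) : ℚ) * β = -(α + l * β) := by linear_combination h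
  rw [heq, abs_neg] at hstep
  obtain h0 | h0 := root_separation (α := α) (β := β) hβ₀ hne hl
  · rw [h0, neg_zero] at heq
    have hb : β = 0 := by
      have := (mul_eq_zero.1 heq).resolve_left (by positivity)
      exact_mod_cast this
    subst hb
    simp only [Int.cast_zero, mul_zero, add_zero] at h0
    exact ⟨by exact_mod_cast h0, rfl⟩
  · linarith

/-- A negative value at `l` would be at most -1/H and could not be made up for within the step. So
the function is nonnegative at both ends of the interval and, being affine, in between. -/
theorem dominates_next {H α₀ β₀ : ℤ} {l : ℚ} (hβ₀ : |β₀| ≤ H) (hne : β₀ ≠ 0)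
    (hl : (α₀ : ℚ) + l * β₀ = 0) :
    Dominates H (l + 1 / (2 * H ^ 2))
      {t | (l : ℝ) ≤ t ∧ t ≤ ((l + 1 / (2 * H ^ 2) : ℚ) : ℝ)} := by
  intro α β hα hβ h t ⟨ht₁, ht₂⟩
  have hH : 0 < H := (abs_pos.2 hne).trans_le hβ₀
  have hHQ : (0 : ℚ) < H := by exact_mod_cast hH
  have hstep := abs_mul_step hH hβ
  have hl0 : 0 ≤ (α : ℚ) + l * β := by
    obtain h0 | h0 := root_separation (α := α) (β := β) hβ₀ hne hl
    · exact h0.ge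
    · by_contra hneg
      push Not at hneg
      rw [abs_of_neg hneg] at h0
      have := le_abs_self ((1 / (2 * H ^ 2) : ℚ) * β)
      nlinarith
  have hl0' : (0 : ℝ) ≤ α + l * β := by exact_mod_cast hl0
  have h' : (0 : ℝ) ≤ α + ((l + 1 / (2 * H ^ 2) : ℚ) : ℝ) * β := by exact_mod_cast h
  obtain hb | hb := le_total (0 : ℝ) β <;> nlinarith

/-! ## One step of the sweep -/

section Sweep

variable {n : ℕ} (a b : Fin n → ℤ) (N : ℕ)

/-- The affine function `aM + t * bM` is the maximum of `0` and of the profits at `s`. -/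
structure IsTop (s : ℚ) (aM bM : ℤ) : Prop where
  mem : aM = 0 ∧ bM = 0 ∨ ∃ m, 0 < (a m : ℚ) + s * b m ∧ aM = a m ∧ bM = b m
  nonneg : 0 ≤ (aM : ℚ) + s * bM
  le : ∀ i, (a i : ℚ) + s * b i ≤ aM + s * bM

/-- The profits at `s`, rounded down to multiples of the fraction `1 / N` of their maximum. -/
def level (s : ℚ) (aM bM : ℤ) (i : Fin n) : ℕ :=
  ⌊N * ((a i : ℚ) + s * b i) / (aM + s * bM)⌋₊

/-- The affine functions of the first `j` items that have to remain nonnegative as long as the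
rounded profits do not change. -/
def IsEvent (s : ℚ) (aM bM : ℤ) (j : ℕ) (α β : ℤ) : Prop :=
  (α = aM ∧ β = bM) ∨
    ∃ i : Fin n, (i : ℕ) < j ∧
      ((α = (level a b N s aM bM i + 1) * aM - N * a i ∧
          β = (level a b N s aM bM i + 1) * bM - N * b i) ∨
        (0 < level a b N s aM bM i ∧ α = N * a i - level a b N s aM bM i * aM ∧
          β = N * b i - level a b N s aM bM i * bM))

/-- The reciprocal of the distance from `s` to the next root of the affine function. -/
def rootRate (s : ℚ) (α β : ℤ) : ℚ := -β / (α + s * β)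

/-- `ρ` is the reciprocal of the distance from `s` to the next event, or zero if there is none. -/
structure IsRate (s : ℚ) (aM bM : ℤ) (j : ℕ) (ρ : ℚ) : Prop where
  nonneg : 0 ≤ ρ
  le : ∀ α β, IsEvent a b N s aM bM j α β → rootRate s α β ≤ ρ
  mem : ρ = 0 ∨ ∃ α β, IsEvent a b N s aM bM j α β ∧ rootRate s α β = ρ

/-- A bound for the coefficients of all events. -/
def coeffBound : ℤ := 1 + 3 * N * ∑ i, (a i ^ 2 + b i ^ 2)

variable {a b N} {s : ℚ} {aM bM : ℤ}

/-- Truncation at zero destroys the lower bound for negative profits, hence the second alternative.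
It also covers a vanishing maximum, where division by zero gives level zero. -/
theorem IsTop.le_of_level (h : IsTop a b s aM bM) (i : Fin n) :
    level a b N s aM bM i * ((aM : ℚ) + s * bM) ≤ N * ((a i : ℚ) + s * b i) ∨
      level a b N s aM bM i = 0 := by
  by_cases hk : level a b N s aM bM i = 0
  · exact Or.inr hk
  · left
    have hpos : 0 < (aM : ℚ) + s * bM := by
      refine h.nonneg.lt_of_ne fun h0 => hk ?_
      simp [level, ← h0]
    have h1 : ((level a b N s aM bM i : ℕ) : ℚ) ≤ N * ((a i : ℚ) + s * b i) / (aM + s * bM) :=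
      (Nat.le_floor_iff' hk).1 le_rfl
    rwa [le_div_iff₀ hpos] at h1

theorem IsTop.le_level (h : IsTop a b s aM bM) (i : Fin n) :
    N * ((a i : ℚ) + s * b i) ≤ (level a b N s aM bM i + 1) * ((aM : ℚ) + s * bM) := by
  obtain h0 | hpos := h.nonneg.eq_or_lt
  · have := h.le i
    rw [← h0] at this ⊢
    rw [mul_zero]
    exact mul_nonpos_of_nonneg_of_nonpos (by positivity) this
  · have := (Nat.lt_floor_add_one (N * ((a i : ℚ) + s * b i) / (aM + s * bM))).le
    rwa [div_le_iff₀ hpos] at this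

theorem IsTop.level_le (h : IsTop a b s aM bM) (i : Fin n) : level a b N s aM bM i ≤ N := by
  by_cases hk : level a b N s aM bM i = 0
  · omega
  · have hpos : 0 < (aM : ℚ) + s * bM := by
      refine h.nonneg.lt_of_ne fun h0 => hk ?_
      simp [level, ← h0]
    have h1 := (h.le_of_level (N := N) i).resolve_right hk
    have h2 : (N : ℚ) * ((a i : ℚ) + s * b i) ≤ N * ((aM : ℚ) + s * bM) :=
      mul_le_mul_of_nonneg_left (h.le i) (by positivity)
    exact_mod_cast le_of_mul_le_mul_right (h1.trans h2) hpos

theorem IsTop.pos_of_level_pos (h : IsTop a b s aM bM) {i : Fin n}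
    (hi : 0 < level a b N s aM bM i) : 0 < (aM : ℚ) + s * bM := by
  refine h.nonneg.lt_of_ne fun h0 => hi.ne' ?_
  simp [level, ← h0]

theorem IsTop.exists_of_pos (h : IsTop a b s aM bM) (hpos : 0 < (aM : ℚ) + s * bM) :
    ∃ m, aM = a m ∧ bM = b m := by
  obtain ⟨h1, h2⟩ | ⟨m, -, hm⟩ := h.mem
  · simp [h1, h2] at hpos
  · exact ⟨m, hm⟩

theorem IsEvent.nonneg (h : IsTop a b s aM bM) {j : ℕ} {α β : ℤ}
    (he : IsEvent a b N s aM bM j α β) : 0 ≤ (α : ℚ) + s * β := by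
  obtain ⟨rfl, rfl⟩ | ⟨i, -, ⟨rfl, rfl⟩ | ⟨hi, rfl, rfl⟩⟩ := he
  · exact h.nonneg
  · have := h.le_level (N := N) i
    push_cast
    linarith
  · have := (h.le_of_level (N := N) i).resolve_right hi.ne'
    push_cast
    linarith

/-- An integer is at most its square in absolute value; sums of squares give a bound that the
program computes without case distinctions. -/
theorem abs_coeff_le (i : Fin n) :
    |a i| ≤ ∑ i, (a i ^ 2 + b i ^ 2) ∧ |b i| ≤ ∑ i, (a i ^ 2 + b i ^ 2) := by
  have h : a i ^ 2 + b i ^ 2 ≤ ∑ i, (a i ^ 2 + b i ^ 2) :=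
    Finset.single_le_sum (f := fun i => a i ^ 2 + b i ^ 2) (fun i _ => by positivity)
      (Finset.mem_univ i)
  have ha : |a i| ≤ a i ^ 2 := by
    rw [← sq_abs]; nlinarith [Int.le_self_sq |a i|]
  have hb : |b i| ≤ b i ^ 2 := by
    rw [← sq_abs]; nlinarith [Int.le_self_sq |b i|]
  exact ⟨by nlinarith [sq_nonneg (b i)], by nlinarith [sq_nonneg (a i)]⟩

/-- Levels are at most N, so the multipliers in an event add up to at most (N + 1) + N ≤ 3N. Taking
k = l = 1 covers differences of two profits. -/
theorem abs_comb_le {N : ℕ} (hN : 0 < N) {S x y k l : ℤ} (hx : |x| ≤ S) (hy : |y| ≤ S)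
    (hk : 0 ≤ k) (hl : 0 ≤ l) (hkl : k + l ≤ 2 * N + 1) : |k * x - l * y| ≤ 1 + 3 * N * S := by
  have hS : 0 ≤ S := (abs_nonneg x).trans hx
  have hN' : (1 : ℤ) ≤ N := by exact_mod_cast hN
  calc |k * x - l * y| ≤ |k * x| + |l * y| := abs_sub _ _
    _ = k * |x| + l * |y| := by rw [abs_mul, abs_mul, abs_of_nonneg hk, abs_of_nonneg hl]
    _ ≤ k * S + l * S := by gcongr
    _ ≤ 1 + 3 * N * S := by nlinarith

theorem IsTop.abs_le (h : IsTop a b s aM bM) :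
    |aM| ≤ ∑ i, (a i ^ 2 + b i ^ 2) ∧ |bM| ≤ ∑ i, (a i ^ 2 + b i ^ 2) := by
  obtain ⟨rfl, rfl⟩ | ⟨m, -, rfl, rfl⟩ := h.mem
  · have : 0 ≤ ∑ i, (a i ^ 2 + b i ^ 2) := Finset.sum_nonneg fun i _ => by positivity
    simpa using this
  · exact abs_coeff_le m

theorem IsEvent.abs_le (hN : 0 < N) (h : IsTop a b s aM bM) {j : ℕ} {α β : ℤ}
    (he : IsEvent a b N s aM bM j α β) : |α| ≤ coeffBound a b N ∧ |β| ≤ coeffBound a b N := by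
  unfold coeffBound
  obtain ⟨h1, h2⟩ := h.abs_le
  obtain ⟨rfl, rfl⟩ | ⟨i, -, h'⟩ := he
  · have h3 := abs_comb_le hN h1 h1 (k := 1) (l := 0) (by norm_num) le_rfl (by omega)
    have h4 := abs_comb_le hN h2 h2 (k := 1) (l := 0) (by norm_num) le_rfl (by omega)
    simp only [one_mul, zero_mul, sub_zero] at h3 h4
    exact ⟨h3, h4⟩
  · obtain ⟨h3, h4⟩ := abs_coeff_le (a := a) (b := b) i
    have h5 := h.level_le (N := N) i
    obtain ⟨rfl, rfl⟩ | ⟨hi, rfl, rfl⟩ := h'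
    · exact ⟨abs_comb_le hN h1 h3 (by positivity) (by positivity) (by omega),
        abs_comb_le hN h2 h4 (by positivity) (by positivity) (by omega)⟩
    · exact ⟨abs_comb_le hN h3 h1 (by positivity) (by positivity) (by omega),
        abs_comb_le hN h4 h2 (by positivity) (by positivity) (by omega)⟩

theorem IsEvent.pos (hN : 0 < N) (h : IsTop a b s aM bM) (hs : Generic (coeffBound a b N) s)
    {j : ℕ} {α β : ℤ} (he : IsEvent a b N s aM bM j α β) (hβ : β ≠ 0) : 0 < (α : ℚ) + s * β :=
  (he.nonneg h).lt_of_ne fun h0 =>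
    hβ (hs α β (he.abs_le hN h).1 (he.abs_le hN h).2 h0.symm).2

/-- If there is no further event, all events are nonnegative to the right of `s`. -/
theorem IsRate.nonneg_of_zero (hN : 0 < N) (h : IsTop a b s aM bM)
    (hs : Generic (coeffBound a b N) s) (hρ : IsRate a b N s aM bM n 0) {α β : ℤ}
    (he : IsEvent a b N s aM bM n α β) {t : ℝ} (ht : s ≤ t) : 0 ≤ (α : ℝ) + t * β := by
  have h0 : (0 : ℝ) ≤ α + s * β := by exact_mod_cast he.nonneg h
  have hβ : 0 ≤ β := by
    by_contra hneg
    have h1 := hρ.le α β he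
    have hpos := he.pos hN h hs (by omega)
    have : 0 < rootRate s α β := div_pos (by simpa using hneg) hpos
    linarith
  have hβ' : (0 : ℝ) ≤ β := by exact_mod_cast hβ
  nlinarith

/-- All events are nonnegative between `s` and the next event. -/
theorem IsRate.nonneg_of_pos (hN : 0 < N) (h : IsTop a b s aM bM)
    (hs : Generic (coeffBound a b N) s) {ρ : ℚ} (hρ : IsRate a b N s aM bM n ρ) (hρ0 : 0 < ρ)
    {α β : ℤ} (he : IsEvent a b N s aM bM n α β) {t : ℝ} (ht : s ≤ t)
    (ht' : t ≤ ((s + 1 / ρ : ℚ) : ℝ)) : 0 ≤ (α : ℝ) + t * β := by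
  have h0 : (0 : ℝ) ≤ α + s * β := by exact_mod_cast he.nonneg h
  have h1 : (0 : ℚ) ≤ α + (s + 1 / ρ) * β := by
    obtain hβ | hβ := le_or_gt 0 β
    · have := he.nonneg h
      have : (0 : ℚ) ≤ 1 / ρ * β := by positivity
      linarith
    · have hpos := he.pos hN h hs hβ.ne
      have h2 := hρ.le α β he
      rw [rootRate, div_le_iff₀ hpos] at h2
      have h3 : 1 / ρ * -β ≤ 1 / ρ * (ρ * (α + s * β)) := by gcongr
      rw [← mul_assoc, one_div_mul_cancel hρ0.ne', one_mul] at h3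
      linarith
  have h1' : (0 : ℝ) ≤ α + ((s + 1 / ρ : ℚ) : ℝ) * β := by exact_mod_cast h1
  obtain hb | hb := le_total (0 : ℝ) β <;> nlinarith

/-- The next breakpoint is the root of an event, hence of a function with bounded coefficients, as
`generic_next` and `dominates_next` require; β < 0 makes the event fail beyond it. -/
theorem IsRate.exists_root (hN : 0 < N) (h : IsTop a b s aM bM)
    (hs : Generic (coeffBound a b N) s) {ρ : ℚ} (hρ : IsRate a b N s aM bM n ρ) (hρ0 : 0 < ρ) :
    ∃ α β, IsEvent a b N s aM bM n α β ∧ β < 0 ∧ (α : ℚ) + (s + 1 / ρ) * β = 0 := by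
  obtain ⟨α, β, he, h1⟩ := hρ.mem.resolve_left hρ0.ne'
  have hne : β ≠ 0 := by
    rintro rfl
    simp [rootRate] at h1
    exact hρ0.ne h1
  have hpos := he.pos hN h hs hne
  rw [rootRate, div_eq_iff hpos.ne'] at h1
  refine ⟨α, β, he, ?_, ?_⟩
  · have : (0 : ℚ) < -β := by rw [h1]; positivity
    have : (β : ℚ) < 0 := by linarith
    exact_mod_cast this
  · have : (β : ℚ) = -(ρ * (α + s * β)) := by linarith
    have h3 : 1 / ρ * (β : ℚ) = -(α + s * β) := by
      rw [this, mul_neg, ← mul_assoc, one_div_mul_cancel hρ0.ne', one_mul, ← this]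
    linarith

/-- As long as the events are nonnegative, the approximate solutions for the rounded profits stay
approximate solutions. -/
theorem IsTop.isApprox (hN : 0 < N) {ε : ℝ} (h₀ : 0 < ε) (h₁ : ε < 1) (hnN : 2 * n ≤ ε * N)
    (h : IsTop a b s aM bM) {t : ℝ}
    (ht : ∀ α β, IsEvent a b N s aM bM n α β → 0 ≤ (α : ℝ) + t * β) {K : Knapsack n}
    {x : Finset (Fin n)} (hx : K.IsApprox (ε / 2) (fun i => (level a b N s aM bM i : ℝ)) x) :
    K.IsApprox ε (fun i => (a i : ℝ) + t * b i)
      (x.filter fun i => 0 < level a b N s aM bM i) := by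
  refine Knapsack.IsApprox.of_rounded (M := (aM : ℝ) + t * bM) h₀ h₁ hN hnN ?_ ?_ ?_ ?_ hx
  · exact ht _ _ (Or.inl ⟨rfl, rfl⟩)
  · intro i
    have := ht _ _ (Or.inr ⟨i, i.2, Or.inl ⟨rfl, rfl⟩⟩)
    push_cast at this
    linarith
  · intro i hi
    have := ht _ _ (Or.inr ⟨i, i.2, Or.inr ⟨hi, rfl, rfl⟩⟩)
    push_cast at this
    linarith
  · obtain ⟨rfl, rfl⟩ | ⟨m, hm, rfl, rfl⟩ := h.mem
    · simp
    · right
      -- The item attaining the maximum at `s` has level exactly N, whatever `t` is.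
      refine ⟨m, ?_⟩
      rw [level, mul_div_cancel_right₀ _ hm.ne']
      simp

/-! ## The number of steps -/

variable (a b N) in
/-- The parameter values at which the rounded profit of item `i` is at least `k`. -/
def levelSet (i : Fin n) (k : ℕ) : Set ℚ :=
  {t | 0 < (a i : ℚ) + t * b i ∧ ∀ j, k * ((a j : ℚ) + t * b j) ≤ N * ((a i : ℚ) + t * b i)}

/-- The set is cut out by affine inequalities and is therefore convex. -/
theorem mem_levelSet_of_between {i : Fin n} {k : ℕ} {t₁ t t₂ : ℚ} (h₁ : t₁ ∈ levelSet a b N i k)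
    (h₂ : t₂ ∈ levelSet a b N i k) (h : t₁ ≤ t) (h' : t ≤ t₂) : t ∈ levelSet a b N i k := by
  refine ⟨?_, fun j => ?_⟩
  · have := h₁.1
    have := h₂.1
    obtain hb | hb := le_total (0 : ℚ) (b i) <;> nlinarith
  · have := h₁.2 j
    have := h₂.2 j
    obtain hb | hb := le_total (0 : ℚ) (N * b i - k * b j) <;> nlinarith

variable (a b N) in
/-- Some set of parameter values at which a rounded profit has at least a given positive value
contains exactly one of the points. -/
def Separated (t t' : ℚ) : Prop :=
  ∃ (i : Fin n) (k : ℕ), 1 ≤ k ∧ k ≤ N ∧ ¬ (t ∈ levelSet a b N i k ↔ t' ∈ levelSet a b N i k)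

/-- Charge each step to a level set whose boundary it crosses, together with the direction of
crossing. By convexity an increasing sequence enters and leaves a level set at most once, so the
charging is injective into n · N · 2 possibilities. -/
theorem card_separated_le {c : ℕ} {τ : ℕ → ℚ} (hτ : ∀ j < c, τ j < τ (j + 1))
    (hsep : ∀ j < c, Separated a b N (τ j) (τ (j + 1))) : c ≤ n * (N * 2) := by
  classical
  have hmono : ∀ j j', j ≤ j' → j' ≤ c → τ j ≤ τ j' := by
    intro j j' hjj'
    induction j', hjj' using Nat.le_induction with
    | base => intro _; exact le_rfl
    | succ m hm ih => intro hmc; exact (ih (by omega)).trans (hτ m (by omega)).le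
  choose i k hk1 hkN hik using fun j : Fin c => hsep j j.2
  let f : Fin c → Fin n × Fin N × Bool := fun j =>
    (i j, ⟨k j - 1, by have := hk1 j; have := hkN j; omega⟩,
      decide (τ j ∈ levelSet a b N (i j) (k j)))
  have key : ∀ j j' : Fin c, j < j' → f j ≠ f j' := by
    intro j j' hjj' hf
    simp only [f, Prod.mk.injEq, Fin.mk.injEq, decide_eq_decide] at hf
    obtain ⟨hi, hk, hm⟩ := hf
    have hk' : k j = k j' := by have := hk1 j; have := hk1 j'; omega
    have h1 := hik j
    have h2 := hik j'
    rw [← hi, ← hk'] at h2 hm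
    have hle : τ (j + 1) ≤ τ j' := hmono _ _ hjj' j'.2.le
    have hlt := hτ j j.2
    have hlt' := hτ j' j'.2
    by_cases hj : τ j ∈ levelSet a b N (i j) (k j)
    · exact h1 ⟨fun _ => mem_levelSet_of_between hj (hm.1 hj) hlt.le hle, fun _ => hj⟩
    · have hj1 : τ (j + 1) ∈ levelSet a b N (i j) (k j) := by tauto
      have hj2 : τ (j' + 1) ∈ levelSet a b N (i j) (k j) := by tauto
      exact hj (hm.2 (mem_levelSet_of_between hj1 hj2 hle hlt'.le))
  have hinj : Function.Injective f := by
    intro j j' hf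
    by_contra hne
    obtain h | h := lt_or_gt_of_ne hne
    · exact key j j' h hf
    · exact key j' j h hf.symm
  simpa using Fintype.card_le_of_injective f hinj

variable (a b) in
theorem exists_isTop (s : ℚ) : ∃ aM bM, IsTop a b s aM bM := by
  by_cases h : ∃ i, 0 < (a i : ℚ) + s * b i
  · obtain ⟨i, hi⟩ := h
    obtain ⟨m, -, hm⟩ := Finset.exists_max_image Finset.univ (fun i => (a i : ℚ) + s * b i)
      ⟨i, Finset.mem_univ i⟩
    have hpos := hi.trans_le (hm i (Finset.mem_univ i))
    exact ⟨a m, b m, Or.inr ⟨m, hpos, rfl, rfl⟩, hpos.le, fun j => hm j (Finset.mem_univ j)⟩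
  · push Not at h
    exact ⟨0, 0, Or.inl ⟨rfl, rfl⟩, by simp, by simpa using h⟩

theorem IsTop.mem_levelSet {m : Fin n} (h : IsTop a b s (a m) (b m))
    (hpos : 0 < (a m : ℚ) + s * b m) : s ∈ levelSet a b N m N :=
  ⟨hpos, fun j => mul_le_mul_of_nonneg_left (h.le j) (by positivity)⟩

theorem notMem_levelSet_of_lt (hN : 0 < N) {i j : Fin n}
    (h : (a i : ℚ) + s * b i < a j + s * b j) : s ∉ levelSet a b N i N := by
  intro hs
  have := hs.2 j
  have hN' : (0 : ℚ) < N := by exact_mod_cast hN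
  exact absurd (le_of_mul_le_mul_left this hN') (by linarith)

/-- Points on both sides of an event are separated. -/
theorem IsEvent.separated (hN : 0 < N) (h : IsTop a b s aM bM)
    (hs : Generic (coeffBound a b N) s) {α β : ℤ} (he : IsEvent a b N s aM bM n α β)
    (hβ : β ≠ 0) {s' : ℚ} (hs' : (α : ℚ) + s' * β < 0) : Separated a b N s s' := by
  have hpos := he.pos hN h hs hβ
  -- If the profit of the top item is no longer positive at s', its own set of level N is left.
  have top_lost : ∀ m, aM = a m → bM = b m → 0 < (aM : ℚ) + s * bM → (aM : ℚ) + s' * bM ≤ 0 →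
      Separated a b N s s' := by
    rintro m rfl rfl h1 h2
    exact ⟨m, N, hN, le_rfl, fun hiff => absurd (hiff.1 (h.mem_levelSet h1)).1 (by linarith)⟩
  have main : (∃ m, aM = a m ∧ bM = b m ∧ 0 < (aM : ℚ) + s * bM ∧ 0 < (aM : ℚ) + s' * bM) →
      Separated a b N s s' := by
    rintro ⟨m, rfl, rfl, hm, hm'⟩
    obtain ⟨rfl, rfl⟩ | ⟨i, -, ⟨rfl, rfl⟩ | ⟨hi, rfl, rfl⟩⟩ := he
    · linarith
    · set k := level a b N s (a m) (b m) i with hk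
      push_cast at hs' hpos
      obtain ⟨aM', bM', h'⟩ := exists_isTop a b s'
      obtain ⟨m', rfl, rfl⟩ := h'.exists_of_pos (hm'.trans_le (h'.le m))
      -- If `m` is still maximal at s', item `i` has risen to level k + 1. Otherwise some m' has
      -- overtaken `m`; by genericity m' is strictly below `m` at `s`, so its set of level N is
      -- entered.
      obtain heq | hlt := (h'.le m).eq_or_lt
      · refine ⟨i, k + 1, by omega, ?_, fun hiff => ?_⟩
        · by_contra hkN
          have h1 := mul_le_mul_of_nonneg_left (h'.le i) (Nat.cast_nonneg (α := ℚ) N)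
          have h2 : (N : ℚ) ≤ k + 1 := by exact_mod_cast (by omega : N ≤ k + 1)
          rw [← heq] at h1
          nlinarith
        · have hmem : s' ∈ levelSet a b N i (k + 1) := by
            refine ⟨?_, fun j => ?_⟩
            · have hN' : (0 : ℚ) < N := by exact_mod_cast hN
              have h1 : 0 < ((k : ℚ) + 1) * ((a m : ℚ) + s' * b m) := by positivity
              have h2 : 0 < (N : ℚ) * ((a i : ℚ) + s' * b i) := by linarith
              exact pos_of_mul_pos_right h2 hN'.le
            · have h1 := h'.le j
              rw [← heq] at h1
              have h2 : ((k : ℚ) + 1) * ((a j : ℚ) + s' * b j) ≤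
                  (k + 1) * ((a m : ℚ) + s' * b m) :=
                mul_le_mul_of_nonneg_left h1 (by positivity)
              push_cast
              linarith
          have := (hiff.2 hmem).2 m
          push_cast at this
          linarith
      · refine ⟨m', N, hN, le_rfl, fun hiff => ?_⟩
        have hmem := hiff.2 (h'.mem_levelSet (hm'.trans hlt))
        refine notMem_levelSet_of_lt hN ((h.le m').lt_of_ne fun heq => ?_) hmem
        have h1 := abs_comb_le hN (abs_coeff_le (a := a) (b := b) m').1
          (abs_coeff_le (a := a) (b := b) m).1 (k := 1) (l := 1) (by norm_num) (by norm_num)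
          (by omega)
        have h2 := abs_comb_le hN (abs_coeff_le (a := a) (b := b) m').2
          (abs_coeff_le (a := a) (b := b) m).2 (k := 1) (l := 1) (by norm_num) (by norm_num)
          (by omega)
        obtain ⟨h3, h4⟩ := hs _ _ h1 h2 (by push_cast; linarith)
        have h5 : a m' = a m := by linarith
        have h6 : b m' = b m := by linarith
        rw [h5, h6] at hlt
        exact lt_irrefl _ hlt
    -- Item `i` has level k at `s`, but falls below this level at s'.
    · set k := level a b N s (a m) (b m) i with hk
      push_cast at hs' hpos
      refine ⟨i, k, hi, h.level_le i, fun hiff => ?_⟩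
      have hmem : s ∈ levelSet a b N i k := by
        have hN' : (0 : ℚ) < N := by exact_mod_cast hN
        have hk' : (0 : ℚ) < k := by exact_mod_cast hi
        have h1 : 0 < (k : ℚ) * ((a m : ℚ) + s * b m) := by positivity
        refine ⟨pos_of_mul_pos_right (by linarith : 0 < (N : ℚ) * ((a i : ℚ) + s * b i)) hN'.le,
          fun j => ?_⟩
        have h2 := mul_le_mul_of_nonneg_left (h.le j) hk'.le
        linarith
      have := (hiff.1 hmem).2 m
      linarith
  obtain ⟨rfl, rfl⟩ | ⟨m, hm, rfl, rfl⟩ := h.mem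
  -- With maximum zero no profit is positive at `s`. The event makes one positive at s', and an item
  -- maximal there enters its set of level N.
  · obtain ⟨rfl, rfl⟩ | ⟨i, -, ⟨rfl, rfl⟩ | ⟨hi, rfl, rfl⟩⟩ := he
    · exact absurd rfl hβ
    · simp only [mul_zero, zero_sub] at hs'
      push_cast at hs'
      have hN' : (0 : ℚ) < N := by exact_mod_cast hN
      have hi' : 0 < (a i : ℚ) + s' * b i :=
        pos_of_mul_pos_right (by linarith : 0 < (N : ℚ) * ((a i : ℚ) + s' * b i)) hN'.le
      obtain ⟨aM', bM', h'⟩ := exists_isTop a b s'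
      have hpos' := hi'.trans_le (h'.le i)
      obtain ⟨m', rfl, rfl⟩ := h'.exists_of_pos hpos'
      refine ⟨m', N, hN, le_rfl, fun hiff => ?_⟩
      have h1 := (hiff.2 (h'.mem_levelSet hpos')).1
      have h2 := h.le m'
      simp only [Int.cast_zero, mul_zero, add_zero] at h2
      linarith
    · simpa using h.pos_of_level_pos hi
  · by_cases h2 : 0 < (a m : ℚ) + s' * b m
    · exact main ⟨m, rfl, rfl, hm, h2⟩
    · exact top_lost m rfl rfl hm (not_lt.1 h2)

end Sweep

/-! ## The algorithm -/

/-- With reciprocals the nearest root to the right becomes a maximum, zero stands for an infinite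
distance, and events of nonnegative slope drop out because their rates are not positive. -/
theorem IsRate.init {n : ℕ} {a b : Fin n → ℤ} {N : ℕ} {s : ℚ} {aM bM : ℤ} :
    IsRate a b N s aM bM 0 (max 0 (rootRate s aM bM)) := by
  have h0 : ∀ α β, IsEvent a b N s aM bM 0 α β ↔ α = aM ∧ β = bM := by
    intro α β
    simp [IsEvent]
  refine ⟨le_max_left _ _, fun α β he => ?_, ?_⟩
  · obtain ⟨rfl, rfl⟩ := (h0 α β).1 he
    exact le_max_right _ _
  · obtain h | h := max_choice 0 (rootRate s aM bM)
    · exact Or.inl h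
    · exact Or.inr ⟨aM, bM, (h0 _ _).2 ⟨rfl, rfl⟩, h.symm⟩

/-- The expression for ρ' mirrors the updates made by `levelItemProg`. -/
theorem IsRate.succ {n : ℕ} {a b : Fin n → ℤ} {N : ℕ} {s : ℚ} {aM bM : ℤ} (i : Fin n) {ρ ρ' : ℚ}
    (h : IsRate a b N s aM bM i ρ)
    (hρ' : ρ' = if 0 < level a b N s aM bM i then
      max (max ρ (rootRate s ((level a b N s aM bM i + 1) * aM - N * a i)
        ((level a b N s aM bM i + 1) * bM - N * b i)))
        (rootRate s (N * a i - level a b N s aM bM i * aM)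
        (N * b i - level a b N s aM bM i * bM)) else
      max ρ (rootRate s ((level a b N s aM bM i + 1) * aM - N * a i)
        ((level a b N s aM bM i + 1) * bM - N * b i))) :
    IsRate a b N s aM bM (i + 1) ρ' := by
  have mono : ∀ α β, IsEvent a b N s aM bM i α β → IsEvent a b N s aM bM (i + 1) α β := by
    rintro α β (h | ⟨i', hi', h⟩)
    · exact Or.inl h
    · exact Or.inr ⟨i', by omega, h⟩
  have split : ∀ α β, IsEvent a b N s aM bM (i + 1) α β → IsEvent a b N s aM bM i α β ∨
      ((α = (level a b N s aM bM i + 1) * aM - N * a i ∧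
          β = (level a b N s aM bM i + 1) * bM - N * b i) ∨
        (0 < level a b N s aM bM i ∧ α = N * a i - level a b N s aM bM i * aM ∧
          β = N * b i - level a b N s aM bM i * bM)) := by
    rintro α β (h | ⟨i', hi', h⟩)
    · exact Or.inl (Or.inl h)
    · obtain hlt | heq := (Nat.lt_succ_iff.1 hi').lt_or_eq
      · exact Or.inl (Or.inr ⟨i', hlt, h⟩)
      · rw [Fin.ext heq] at h
        exact Or.inr h
  have new₁ : IsEvent a b N s aM bM (i + 1) ((level a b N s aM bM i + 1) * aM - N * a i)
      ((level a b N s aM bM i + 1) * bM - N * b i) :=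
    Or.inr ⟨i, Nat.lt_succ_self _, Or.inl ⟨rfl, rfl⟩⟩
  have new₂ (hk : 0 < level a b N s aM bM i) :
      IsEvent a b N s aM bM (i + 1) (N * a i - level a b N s aM bM i * aM)
      (N * b i - level a b N s aM bM i * bM) :=
    Or.inr ⟨i, Nat.lt_succ_self _, Or.inr ⟨hk, rfl, rfl⟩⟩
  have old : ρ = 0 ∨ ∃ α β, IsEvent a b N s aM bM (i + 1) α β ∧ rootRate s α β = ρ := by
    obtain h0 | ⟨α, β, he, hr⟩ := h.mem
    · exact Or.inl h0
    · exact Or.inr ⟨α, β, mono α β he, hr⟩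
  have pick : ∀ {x : ℚ} {α β : ℤ},
      (x = 0 ∨ ∃ α β, IsEvent a b N s aM bM (i + 1) α β ∧ rootRate s α β = x) →
      IsEvent a b N s aM bM (i + 1) α β →
      (max x (rootRate s α β) = 0 ∨ ∃ α' β', IsEvent a b N s aM bM (i + 1) α' β' ∧
        rootRate s α' β' = max x (rootRate s α β)) := by
    intro x α β hx he
    obtain h | h := max_choice x (rootRate s α β)
    · rw [h]; exact hx
    · rw [h]; exact Or.inr ⟨α, β, he, rfl⟩
  split_ifs at hρ' with hk
  · subst hρ'
    refine ⟨(h.nonneg.trans (le_max_left _ _)).trans (le_max_left _ _), fun α β he => ?_,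
      pick (pick old new₁) (new₂ hk)⟩
    obtain he | ⟨rfl, rfl⟩ | ⟨-, rfl, rfl⟩ := split α β he
    · exact ((h.le α β he).trans (le_max_left _ _)).trans (le_max_left _ _)
    · exact (le_max_right _ _).trans (le_max_left _ _)
    · exact le_max_right _ _
  · subst hρ'
    refine ⟨h.nonneg.trans (le_max_left _ _), fun α β he => ?_, pick old new₁⟩
    obtain he | ⟨rfl, rfl⟩ | ⟨hk', rfl, rfl⟩ := split α β he
    · exact (h.le α β he).trans (le_max_left _ _)
    · exact le_max_right _ _
    · exact absurd hk' hk

/-- Replace the value of a variable by its maximum with the value of an expression. -/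
def Prog.raise (x : ℕ) (e : Expr) : Prog := .ifLt (.var x) e (.assign x e) .skip

theorem Prog.raise_pre (x : ℕ) (e : Expr) (Q : State → Prop) (s : State) :
    (Prog.raise x e).pre Q s ↔ Q (s.setVar x (max (s.var x) (e.eval s))) := by
  simp only [Prog.raise, Prog.pre, Expr.eval]
  obtain h | h := lt_or_ge (s.var x) (e.eval s)
  · simp [h, h.le]
  · have : s.setVar x (s.var x) = s := by
      cases s
      simp [State.setVar]
    simp [h, this]

section Algorithm

/-!
The variables and arrays of the algorithm have names from `r + 10` on, which the given algorithm
for the ordinary problem does not write to. The variables `r + 10, …, r + 16` contain the number of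
items, the capacity, the number of levels, half the precision, the bound for the coefficients, the
number of breakpoints found and the current parameter value, and `r + 17` is positive until the
sweep is finished; the arrays `r + 10, …, r + 14` contain
the weights, intercepts and slopes, the breakpoints found and the solutions found. The other names
are used for temporary values.
-/

variable (r : ℕ)

/-- Copy the input and compute the constants. -/
def loadProg : Prog :=
  .seq (.assign (r + 10) (.var 0)) <| .seq (.assign (r + 11) (.var 1)) <|
  .seq (.assign (r + 12) (.add (.floor (.div (.mul (.const 2) (.var 0)) (.var 2))) (.const 1))) <|
  .seq (.assign (r + 13) (.div (.var 2) (.const 2))) <|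
  .seq (.assign (r + 14) (.const 0)) (.assign (r + 20) (.const 0))

/-- Copy the data of one item. -/
def loadItemProg : Prog :=
  .seq (.store (r + 10) (.var (r + 20)) (.get 0 (.var (r + 20)))) <|
  .seq (.store (r + 11) (.var (r + 20)) (.get 1 (.var (r + 20)))) <|
  .seq (.store (r + 12) (.var (r + 20)) (.get 2 (.var (r + 20)))) <|
  .seq (.assign (r + 14) (.add (.var (r + 14)) (.add
    (.mul (.get 1 (.var (r + 20))) (.get 1 (.var (r + 20))))
    (.mul (.get 2 (.var (r + 20))) (.get 2 (.var (r + 20))))))) <|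
  .assign (r + 20) (.add (.var (r + 20)) (.const 1))

/-- Choose the first parameter value. -/
def startProg : Prog :=
  .seq (.assign (r + 14) (.add (.const 1)
    (.mul (.mul (.const 3) (.var (r + 12))) (.var (r + 14))))) <|
  .seq (.assign (r + 16) (.sub (.const 0) (.add (.var (r + 14)) (.const 1)))) <|
  .seq (.assign (r + 15) (.const 0)) (.assign (r + 17) (.const 1))

/-- Copy the input, compute the constants and choose the first parameter value. -/
def prologueProg : Prog :=
  .seq (loadProg r) (.seq (.whileLt (.var (r + 20)) (.var (r + 10)) (loadItemProg r)) (startProg r))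

/-- Start the search for the maximum profit at the current parameter value. -/
def topInitProg : Prog :=
  .seq (.assign (r + 20) (.const 0)) <| .seq (.assign (r + 21) (.const 0)) <|
  .assign (r + 22) (.const 0)

/-- Compare the maximum profit with the profit of one item. -/
def topItemProg : Prog :=
  .seq (.ifLt (.add (.var (r + 21)) (.mul (.var (r + 16)) (.var (r + 22))))
      (.add (.get (r + 11) (.var (r + 20)))
        (.mul (.var (r + 16)) (.get (r + 12) (.var (r + 20)))))
      (.seq (.assign (r + 21) (.get (r + 11) (.var (r + 20))))
        (.assign (r + 22) (.get (r + 12) (.var (r + 20)))))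
      .skip) <|
  .assign (r + 20) (.add (.var (r + 20)) (.const 1))

/-- Find the maximum profit at the current parameter value. -/
def topProg : Prog :=
  .seq (topInitProg r) (.whileLt (.var (r + 20)) (.var (r + 10)) (topItemProg r))

/-- Take an affine function into account in the search for the next event. -/
def eventProg : Prog :=
  .raise (r + 24) (.div (.sub (.const 0) (.var (r + 29)))
    (.add (.var (r + 28)) (.mul (.var (r + 16)) (.var (r + 29)))))

/-- Start the computation of the rounded profits and of the next event. -/
def levelInitProg : Prog :=
  .seq (.assign (r + 20) (.const 0)) <|
  .seq (.assign (r + 23) (.add (.var (r + 21)) (.mul (.var (r + 16)) (.var (r + 22))))) <|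
  .seq (.assign (r + 24) (.const 0)) <|
  .seq (.assign (r + 28) (.var (r + 21))) <| .seq (.assign (r + 29) (.var (r + 22))) <|
  eventProg r

/-- Compute the rounded profit of one item and its events, and restore its weight. -/
def levelItemProg : Prog :=
  .seq (.assign (r + 25) (.floor (.div (.mul (.var (r + 12))
    (.add (.get (r + 11) (.var (r + 20)))
      (.mul (.var (r + 16)) (.get (r + 12) (.var (r + 20)))))) (.var (r + 23))))) <|
  .seq (.raise (r + 25) (.const 0)) <|
  .seq (.store 0 (.var (r + 20)) (.get (r + 10) (.var (r + 20)))) <|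
  .seq (.store 1 (.var (r + 20)) (.var (r + 25))) <|
  .seq (.store (r + 20) (.var (r + 20)) (.var (r + 25))) <|
  .seq (.assign (r + 28) (.sub (.mul (.add (.var (r + 25)) (.const 1)) (.var (r + 21)))
    (.mul (.var (r + 12)) (.get (r + 11) (.var (r + 20)))))) <|
  .seq (.assign (r + 29) (.sub (.mul (.add (.var (r + 25)) (.const 1)) (.var (r + 22)))
    (.mul (.var (r + 12)) (.get (r + 12) (.var (r + 20)))))) <|
  .seq (eventProg r) <|
  .seq (.ifLt (.const 0) (.var (r + 25))
    (.seq (.assign (r + 28) (.sub (.mul (.var (r + 12)) (.get (r + 11) (.var (r + 20))))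
      (.mul (.var (r + 25)) (.var (r + 21))))) <|
    .seq (.assign (r + 29) (.sub (.mul (.var (r + 12)) (.get (r + 12) (.var (r + 20))))
      (.mul (.var (r + 25)) (.var (r + 22))))) <|
    eventProg r) .skip) <|
  .assign (r + 20) (.add (.var (r + 20)) (.const 1))

/-- Compute the rounded profits and the next event. -/
def levelProg : Prog :=
  .seq (levelInitProg r) (.whileLt (.var (r + 20)) (.var (r + 10)) (levelItemProg r))

/-- Restore the number of items and the capacity, and provide the precision. -/
def restoreProg : Prog :=
  .seq (.assign 0 (.var (r + 10))) <| .seq (.assign 1 (.var (r + 11))) <|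
  .assign 2 (.var (r + 13))

/-- Apply the algorithm `P` for the ordinary problem to the rounded profits. -/
def callProg (P : Prog) : Prog := .seq (restoreProg r) P

/-- Append one item to the list of solutions, unless its rounded profit is zero. -/
def collectItemProg : Prog :=
  .seq (.ifLt (.const 0) (.get (r + 20) (.var (r + 20)))
    (.store (r + 14) (.add (.mul (.var (r + 15)) (.var (r + 10))) (.var (r + 20)))
      (.get 2 (.var (r + 20))))
    (.store (r + 14) (.add (.mul (.var (r + 15)) (.var (r + 10))) (.var (r + 20)))
      (.const 0))) <|
  .assign (r + 20) (.add (.var (r + 20)) (.const 1))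

/-- Append the items with positive rounded profits in the computed solution to the list of
solutions. -/
def collectProg : Prog :=
  .seq (.assign (r + 20) (.const 0)) <|
  .whileLt (.var (r + 20)) (.var (r + 10)) (collectItemProg r)

/-- Proceed to a parameter value behind the next event. -/
def advanceProg : Prog :=
  .ifLt (.const 0) (.var (r + 24))
    (.seq (.store (r + 13) (.var (r + 15)) (.add (.var (r + 16))
      (.div (.const 1) (.var (r + 24))))) <|
    .seq (.assign (r + 16) (.add (.add (.var (r + 16)) (.div (.const 1) (.var (r + 24))))
      (.div (.const 1) (.mul (.const 2) (.mul (.var (r + 14)) (.var (r + 14))))))) <|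
    .assign (r + 15) (.add (.var (r + 15)) (.const 1)))
    (.assign (r + 17) (.const 0))

/-- One step of the sweep. -/
def stepProg (P : Prog) : Prog :=
  .seq (topProg r) <| .seq (levelProg r) <| .seq (callProg r P) <| .seq (collectProg r) <|
  advanceProg r

/-- Output one breakpoint. -/
def outputPointProg : Prog :=
  .seq (.store 3 (.var (r + 20)) (.get (r + 13) (.var (r + 20)))) <|
  .assign (r + 20) (.add (.var (r + 20)) (.const 1))

/-- Output one cell of the list of solutions. -/
def outputCellProg : Prog :=
  .seq (.store 4 (.var (r + 20)) (.get (r + 14) (.var (r + 20)))) <|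
  .assign (r + 20) (.add (.var (r + 20)) (.const 1))

/-- Output the breakpoints and the solutions. -/
def epilogueProg : Prog :=
  .seq (.seq (.assign 3 (.var (r + 15))) (.assign (r + 20) (.const 0))) <|
  .seq (.whileLt (.var (r + 20)) (.var (r + 15)) (outputPointProg r)) <|
  .seq (.seq (.assign (r + 27) (.mul (.add (.var (r + 15)) (.const 1)) (.var (r + 10))))
    (.assign (r + 20) (.const 0))) <|
  .whileLt (.var (r + 20)) (.var (r + 27)) (outputCellProg r)

/-- The algorithm for the parametric problem. -/
def sweepProg (P : Prog) : Prog :=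
  .seq (prologueProg r) <| .seq (.whileLt (.const 0) (.var (r + 17)) (stepProg r P)) <|
  epilogueProg r

/-- The permanent data of the algorithm is the same in both states. -/
def Agree (s s' : State) : Prop :=
  ∀ x, r + 10 ≤ x → x < r + 20 → s'.var x = s.var x ∧ s'.arr x = s.arr x

variable {n : ℕ} (I : ParametricInstance n) (ε : ℚ) (N : ℕ)

/-- The constants and the copies of the input have been set up. -/
structure Consts (s : State) : Prop where
  card : s.var (r + 10) = n
  capacity : s.var (r + 11) = I.capacity
  levels : s.var (r + 12) = N
  precision : s.var (r + 13) = ε / 2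
  bound : s.var (r + 14) = coeffBound I.intercept I.slope N
  weight : ∀ i : Fin n, s.arr (r + 10) i = I.weight i
  intercept : ∀ i : Fin n, s.arr (r + 11) i = I.intercept i
  slope : ∀ i : Fin n, s.arr (r + 12) i = I.slope i

variable {r I ε N}

/-! ### Correctness and running time of the subprograms. -/

theorem Consts.congr {s s' : State} (h : Consts r I ε N s)
    (hv : ∀ x, r + 10 ≤ x → x < r + 15 → s'.var x = s.var x)
    (ha : ∀ x, r + 10 ≤ x → x < r + 13 → s'.arr x = s.arr x) : Consts r I ε N s' where
  card := by rw [hv _ (by omega) (by omega), h.card]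
  capacity := by rw [hv _ (by omega) (by omega), h.capacity]
  levels := by rw [hv _ (by omega) (by omega), h.levels]
  precision := by rw [hv _ (by omega) (by omega), h.precision]
  bound := by rw [hv _ (by omega) (by omega), h.bound]
  weight := by rw [ha _ (by omega) (by omega)]; exact h.weight
  intercept := by rw [ha _ (by omega) (by omega)]; exact h.intercept
  slope := by rw [ha _ (by omega) (by omega)]; exact h.slope

theorem Consts.agree {s s' : State} (h : Consts r I ε N s) (ha : Agree r s s') :
    Consts r I ε N s' :=
  h.congr (fun x h₁ h₂ => (ha x h₁ (by omega)).1) (fun x h₁ h₂ => (ha x h₁ (by omega)).2)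

theorem Agree.trans {s s' s'' : State} (h : Agree r s s') (h' : Agree r s' s'') : Agree r s s'' :=
  fun x h₁ h₂ => ⟨(h' x h₁ h₂).1.trans (h x h₁ h₂).1, (h' x h₁ h₂).2.trans (h x h₁ h₂).2⟩

theorem prologue_runs {s : State} (hs : LoadsParametric I ε s)
    (hN : (N : ℚ) = ⌊2 * (n : ℚ) / ε⌋ + 1) :
    Runs (prologueProg r) s (100 * (n + 1)) fun s' => Consts r I ε N s' ∧
      s'.var (r + 16) = -(coeffBound I.intercept I.slope N + 1) ∧ s'.var (r + 15) = 0 ∧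
      s'.var (r + 17) = 1 := by
  obtain ⟨⟨h0, h1, h2, hw⟩, ha, hb⟩ := hs
  let Inv : ℕ → State → Prop := fun j s' =>
    s'.var (r + 20) = j ∧ s'.var (r + 10) = n ∧ s'.var (r + 11) = I.capacity ∧
    s'.var (r + 12) = N ∧ s'.var (r + 13) = ε / 2 ∧
    s'.var (r + 14) = ∑ m ∈ Finset.range j, (s.arr 1 m * s.arr 1 m + s.arr 2 m * s.arr 2 m) ∧
    (∀ m, m < r + 10 → s'.arr m = s.arr m) ∧
    ∀ i : Fin n, (i : ℕ) < j → s'.arr (r + 10) i = s.arr 0 i ∧ s'.arr (r + 11) i = s.arr 1 i ∧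
      s'.arr (r + 12) i = s.arr 2 i
  have init : Runs (loadProg r) s 30 (Inv 0) := by
    refine Prog.runs_of_pre _ (by simp [loadProg, Prog.size, Expr.cost]) ?_
    simp [loadProg, Prog.pre, Expr.eval, Inv, h0, h1, h2, hN]
  have loop : ∀ s', Inv 0 s' → Runs (.whileLt (.var (r + 20)) (.var (r + 10)) (loadItemProg r)) s'
      (n * (1 + 2 + 40) + (1 + 2)) (Inv n) := by
    intro s' hs'
    refine Runs.count (f := .var (r + 10)) (fun j s h => ⟨h.1, h.2.1⟩) (fun j s₁ hj h => ?_) hs'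
    obtain ⟨hi, hn, hW, hK, he, hS, harr, hcop⟩ := h
    refine Prog.runs_of_pre _ (by simp [loadItemProg, Prog.size, Expr.cost]) ?_
    have e0 : s₁.arr 0 = s.arr 0 := harr 0 (by omega)
    have e1 : s₁.arr 1 = s.arr 1 := harr 1 (by omega)
    have e2 : s₁.arr 2 = s.arr 2 := harr 2 (by omega)
    simp only [loadItemProg, Prog.pre, Expr.eval, Inv]
    simp [State.setCell_arr, hi, hn, hW, hK, he, hS, Finset.sum_range_succ, e0, e1, e2]
    refine ⟨fun m hm => ?_, fun i hij => ?_⟩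
    · have h1 : m ≠ r + 12 := by omega
      have h2 : m ≠ r + 11 := by omega
      have h3 : m ≠ r + 10 := by omega
      simp [h1, h2, h3, harr m hm]
    · by_cases hij' : (i : ℕ) = j
      · simp [hij']
      · have := hcop i (by omega)
        simp [hij', this]
  have last : ∀ s', Inv n s' → Runs (startProg r) s' 20 fun s' => Consts r I ε N s' ∧
      s'.var (r + 16) = -(coeffBound I.intercept I.slope N + 1) ∧ s'.var (r + 15) = 0 ∧
      s'.var (r + 17) = 1 := by
    rintro s' ⟨hi, hn, hW, hK, he, hS, harr, hcop⟩
    refine Prog.runs_of_pre _ (by simp [startProg, Prog.size, Expr.cost]) ?_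
    have hsum : (∑ m ∈ Finset.range n, (s.arr 1 m * s.arr 1 m + s.arr 2 m * s.arr 2 m)) =
        ((∑ i, (I.intercept i ^ 2 + I.slope i ^ 2) : ℤ) : ℚ) := by
      rw [Finset.sum_range]
      push_cast
      exact Finset.sum_congr rfl fun i _ => by rw [ha, hb]; ring
    rw [hsum] at hS
    simp only [startProg, Prog.pre, Expr.eval]
    refine ⟨⟨?_, ?_, ?_, ?_, ?_, ?_, ?_, ?_⟩, ?_, ?_, ?_⟩
    · simp [hn]
    · simp [hW]
    · simp [hK]
    · simp [he]
    · simp [hK, hS, coeffBound]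
    · intro i; simp [(hcop i i.2).1, hw]
    · intro i; simp [(hcop i i.2).2.1, ha]
    · intro i; simp [(hcop i i.2).2.2, hb]
    · simp [hK, hS, coeffBound]
    · simp
    · simp
  exact (init.seq fun s' h' => (loop s' h').seq last).mono (by omega) fun _ => id

theorem top_runs {s : State} (hs : Consts r I ε N s) :
    Runs (topProg r) s (100 * (n + 1)) fun s' => Agree r s s' ∧ ∃ aM bM : ℤ,
      s'.var (r + 21) = aM ∧ s'.var (r + 22) = bM ∧
        IsTop I.intercept I.slope (s.var (r + 16)) aM bM := by
  let Inv : ℕ → State → Prop := fun j s' => s'.var (r + 20) = j ∧ Agree r s s' ∧ ∃ aM bM : ℤ,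
      s'.var (r + 21) = aM ∧ s'.var (r + 22) = bM ∧
      (aM = 0 ∧ bM = 0 ∨ ∃ m, 0 < (I.intercept m : ℚ) + s.var (r + 16) * I.slope m ∧
        aM = I.intercept m ∧ bM = I.slope m) ∧
      0 ≤ (aM : ℚ) + s.var (r + 16) * bM ∧
      ∀ i : Fin n, (i : ℕ) < j →
        (I.intercept i : ℚ) + s.var (r + 16) * I.slope i ≤ aM + s.var (r + 16) * bM
  have init : Runs (topInitProg r) s 10 (Inv 0) := by
    refine Prog.runs_of_pre _ (by simp [topInitProg, Prog.size, Expr.cost]) ?_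
    simp only [topInitProg, Prog.pre, Expr.eval, Inv]
    refine ⟨by simp, fun x h₁ h₂ => ?_, 0, 0, by simp⟩
    have h1 : x ≠ r + 20 := by omega
    have h2 : x ≠ r + 21 := by omega
    have h3 : x ≠ r + 22 := by omega
    simp [h1, h2, h3]
  have loop : ∀ s', Inv 0 s' → Runs (.whileLt (.var (r + 20)) (.var (r + 10)) (topItemProg r)) s'
      (n * (1 + 2 + 40) + (1 + 2)) (Inv n) := by
    intro s' hs'
    refine Runs.count (f := .var (r + 10))
      (fun j s₁ h => ⟨h.1, (hs.agree h.2.1).card⟩) (fun j s₁ hj h => ?_) hs'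
    obtain ⟨hi, hag, aM, bM, haM, hbM, hmem, hnn, hle⟩ := h
    have hc := hs.agree hag
    have e16 : s₁.var (r + 16) = s.var (r + 16) := (hag _ (by omega) (by omega)).1
    have ea := hc.intercept ⟨j, hj⟩
    have eb := hc.slope ⟨j, hj⟩
    simp only at ea eb
    refine Prog.runs_of_pre _ (by simp [topItemProg, Prog.size, Expr.cost]) ?_
    simp only [topItemProg, Prog.pre, Expr.eval, Inv]
    simp only [State.setVar_var, State.setVar_arr, hi, Nat.floor_natCast, haM, hbM, ea, eb, e16]
    refine ⟨fun hlt => ⟨by simp, fun x h₁ h₂ => ?_, I.intercept ⟨j, hj⟩, I.slope ⟨j, hj⟩, by simp,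
      by simp [eb], Or.inr ⟨_, hnn.trans_lt hlt, rfl, rfl⟩, (hnn.trans_lt hlt).le,
      fun i hij => ?_⟩, fun hnlt => ⟨by simp, fun x h₁ h₂ => ?_, aM, bM, by simp,
      by simp, hmem, hnn, fun i hij => ?_⟩⟩
    · have h1 : x ≠ r + 20 := by omega
      have h2 : x ≠ r + 21 := by omega
      have h3 : x ≠ r + 22 := by omega
      simp [h1, h2, h3, hag x h₁ h₂]
    · by_cases hij' : (i : ℕ) = j
      · have : i = ⟨j, hj⟩ := Fin.ext hij'
        rw [this]
      · exact (hle i (by omega)).trans hlt.le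
    · have h1 : x ≠ r + 20 := by omega
      simp [h1, hag x h₁ h₂]
    · by_cases hij' : (i : ℕ) = j
      · have : i = ⟨j, hj⟩ := Fin.ext hij'
        rw [this]
        exact not_lt.1 hnlt
      · exact hle i (by omega)
  refine (init.seq loop).mono (by omega) ?_
  rintro s' ⟨-, hag, aM, bM, haM, hbM, hmem, hnn, hle⟩
  exact ⟨hag, aM, bM, haM, hbM, hmem, hnn, fun i => hle i i.2⟩

theorem floor_max_zero (x : ℚ) : max (⌊x⌋ : ℚ) 0 = (⌊x⌋₊ : ℚ) := by
  rw [← Int.floor_toNat]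
  have : ((⌊x⌋.toNat : ℤ) : ℚ) = ((max ⌊x⌋ 0 : ℤ) : ℚ) := by rw [Int.toNat_eq_max]
  push_cast at this
  exact this.symm

theorem level_runs {s : State} (hs : Consts r I ε N s) {aM bM : ℤ} (haM : s.var (r + 21) = aM)
    (hbM : s.var (r + 22) = bM) :
    Runs (levelProg r) s (300 * (n + 1)) fun s' => Agree r s s' ∧
      (∀ i : Fin n, s'.arr 0 i = I.weight i ∧
        s'.arr 1 i = level I.intercept I.slope N (s.var (r + 16)) aM bM i ∧
        s'.arr (r + 20) i = level I.intercept I.slope N (s.var (r + 16)) aM bM i) ∧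
      IsRate I.intercept I.slope N (s.var (r + 16)) aM bM n (s'.var (r + 24)) := by
  set σ := s.var (r + 16) with hσ
  let Inv : ℕ → State → Prop := fun j s' => s'.var (r + 20) = j ∧ Agree r s s' ∧
      s'.var (r + 21) = aM ∧ s'.var (r + 22) = bM ∧ s'.var (r + 23) = aM + σ * bM ∧
      (∀ i : Fin n, (i : ℕ) < j → s'.arr 0 i = I.weight i ∧
        s'.arr 1 i = level I.intercept I.slope N σ aM bM i ∧
        s'.arr (r + 20) i = level I.intercept I.slope N σ aM bM i) ∧
      IsRate I.intercept I.slope N σ aM bM j (s'.var (r + 24))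
  have init : Runs (levelInitProg r) s 50 (Inv 0) := by
    refine Prog.runs_of_pre _
      (by simp [levelInitProg, eventProg, Prog.raise, Prog.size, Expr.cost]) ?_
    simp only [levelInitProg, eventProg, Prog.pre, Prog.raise_pre, Expr.eval, Inv]
    refine ⟨by simp, fun x h₁ h₂ => ?_, by simp [haM], by simp [hbM], by simp [haM, hbM, hσ],
      by simp, ?_⟩
    · have h1 : x ≠ r + 20 := by omega
      have h2 : x ≠ r + 23 := by omega
      have h3 : x ≠ r + 24 := by omega
      have h4 : x ≠ r + 28 := by omega
      have h5 : x ≠ r + 29 := by omega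
      simp [h1, h2, h3, h4, h5]
    · have := IsRate.init (a := I.intercept) (b := I.slope) (N := N) (s := σ) (aM := aM) (bM := bM)
      simpa [haM, hbM, rootRate, hσ] using this
  have loop : ∀ s', Inv 0 s' → Runs (.whileLt (.var (r + 20)) (.var (r + 10)) (levelItemProg r)) s'
      (n * (1 + 2 + 200) + (1 + 2)) (Inv n) := by
    intro s' hs'
    refine Runs.count (f := .var (r + 10))
      (fun j s₁ h => ⟨h.1, (hs.agree h.2.1).card⟩) (fun j s₁ hj h => ?_) hs'
    obtain ⟨hi, hag, ha, hb, hv, hcop, hrate⟩ := h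
    have hc := hs.agree hag
    have e16 : s₁.var (r + 16) = σ := (hag _ (by omega) (by omega)).1
    have e12 := hc.levels
    have ew := hc.weight ⟨j, hj⟩
    have ea := hc.intercept ⟨j, hj⟩
    have eb := hc.slope ⟨j, hj⟩
    simp only at ew ea eb
    refine Prog.runs_of_pre _
      (by simp [levelItemProg, eventProg, Prog.raise, Prog.size, Expr.cost]) ?_
    simp only [levelItemProg, eventProg, Prog.pre, Prog.raise_pre, Expr.eval, Inv]
    simp only [State.setVar_var, State.setVar_arr, State.setCell_arr, State.setCell_var,
      Nat.add_left_cancel_iff, Nat.reduceEqDiff, if_true, if_false,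
      hi, Nat.floor_natCast, ha, hb, hv, ew, ea, eb, e16, e12, floor_max_zero]
    have hk : ⌊(N : ℚ) * (I.intercept ⟨j, hj⟩ + σ * I.slope ⟨j, hj⟩) / (aM + σ * bM)⌋₊ =
        level I.intercept I.slope N σ aM bM ⟨j, hj⟩ := rfl
    simp only [hk, Nat.cast_pos]
    have hagree : ∀ s₂ : State, (∀ x, r + 10 ≤ x → x < r + 20 →
        s₂.var x = s₁.var x ∧ s₂.arr x = s₁.arr x) → Agree r s s₂ := fun s₂ h => hag.trans h
    have hcop' : ∀ i : Fin n, (i : ℕ) < j + 1 →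
        Function.update (s₁.arr 0) j (I.weight ⟨j, hj⟩ : ℚ) i = I.weight i ∧
        Function.update (s₁.arr 1) j (level I.intercept I.slope N σ aM bM ⟨j, hj⟩ : ℚ) i =
          level I.intercept I.slope N σ aM bM i ∧
        Function.update (s₁.arr (r + 20)) j (level I.intercept I.slope N σ aM bM ⟨j, hj⟩ : ℚ) i =
          level I.intercept I.slope N σ aM bM i := by
      intro i hij
      by_cases hij' : (i : ℕ) = j
      · have : i = ⟨j, hj⟩ := Fin.ext hij'
        subst this
        simp
      · simpa [hij'] using hcop i (by omega)
    have hsucc := hrate.succ ⟨j, hj⟩ rfl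
    simp only [rootRate] at hsucc
    push_cast at hsucc
    constructor
    · intro hpos
      rw [if_pos hpos] at hsucc
      refine ⟨by push_cast; rfl, hagree _ fun x h₁ h₂ => ?_, trivial, trivial, trivial, hcop', ?_⟩
      · have h1 : x ≠ r + 20 := by omega
        have h2 : x ≠ r + 24 := by omega
        have h3 : x ≠ r + 25 := by omega
        have h4 : x ≠ r + 28 := by omega
        have h5 : x ≠ r + 29 := by omega
        have h6 : x ≠ 0 := by omega
        have h7 : x ≠ 1 := by omega
        simp [State.setCell_arr, h1, h2, h3, h4, h5, h6, h7]
      · simpa only [zero_sub] using hsucc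
    · intro hpos
      rw [if_neg hpos] at hsucc
      refine ⟨by push_cast; rfl, hagree _ fun x h₁ h₂ => ?_, trivial, trivial, trivial, hcop', ?_⟩
      · have h1 : x ≠ r + 20 := by omega
        have h2 : x ≠ r + 24 := by omega
        have h3 : x ≠ r + 25 := by omega
        have h4 : x ≠ r + 28 := by omega
        have h5 : x ≠ r + 29 := by omega
        have h6 : x ≠ 0 := by omega
        have h7 : x ≠ 1 := by omega
        simp [State.setCell_arr, h1, h2, h3, h4, h5, h6, h7]
      · simpa only [zero_sub] using hsucc
  refine (init.seq loop).mono (by omega) ?_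
  rintro s' ⟨-, hag, -, -, -, hcop, hrate⟩
  exact ⟨hag, fun i => hcop i i.2, hrate⟩

/-- Earlier calls may have destroyed the input cells, so `restoreProg` rewrites the scalars, while
`hq` provides the weights and rounded profits. The data of the sweep survives by `Exec.frame`. -/
theorem call_runs {P : Prog} {A : ℕ → ℚ → ℝ} (hP : IsOrdinaryFPTAS P A)
    (hr : P.writeBound ≤ r + 10) (hn : 1 ≤ n) (h₀ : 0 < ε) (h₁ : ε < 1) {s : State}
    (hs : Consts r I ε N s) {q : Fin n → ℕ}
    (hq : ∀ i : Fin n, s.arr 0 i = I.weight i ∧ s.arr 1 i = q i) :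
    Runs (callProg r P) s (6 + ⌊A n (ε / 2)⌋₊) fun s' =>
      (∀ x, r + 10 ≤ x → s'.var x = s.var x ∧ s'.arr x = s.arr x) ∧
      ∃ x : Finset (Fin n), StoresSolution (s'.arr 2) 0 x ∧
        I.IsApprox ((ε : ℝ) / 2) (fun i => (q i : ℝ)) x := by
  let J : OrdinaryInstance n := { I.toKnapsack with profit := q }
  have init : Runs (restoreProg r) s 6 fun s' => LoadsOrdinary J (ε / 2) s' ∧
      ∀ x, r + 10 ≤ x → s'.var x = s.var x ∧ s'.arr x = s.arr x := by
    refine Prog.runs_of_pre _ (by simp [restoreProg, Prog.size, Expr.cost]) ?_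
    simp only [restoreProg, Prog.pre, Expr.eval]
    refine ⟨⟨⟨by simp [hs.card], by simp [hs.capacity, J], by simp [hs.precision],
      fun i => (hq i).1⟩, fun i => (hq i).2⟩, fun x hx => ?_⟩
    have h1 : x ≠ 0 := by omega
    have h2 : x ≠ 1 := by omega
    have h3 : x ≠ 2 := by omega
    simp [h1, h2, h3]
  refine init.seq fun s' ⟨hload, hfr⟩ => ?_
  obtain ⟨t, s'', hex, ht, x, hx, hap⟩ :=
    hP.2 n J (ε / 2) s' hn (by linarith) (by linarith) hload
  refine ⟨t, s'', hex, Nat.le_floor ht, fun y hy => ?_, x, hx, ?_⟩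
  · obtain ⟨h1, h2⟩ := hex.frame hr y hy
    obtain ⟨h3, h4⟩ := hfr y hy
    exact ⟨h1.trans h3, h2.trans h4⟩
  · have : (((ε / 2 : ℚ)) : ℝ) = (ε : ℝ) / 2 := by push_cast; rfl
    rw [this] at hap
    exact hap

theorem collect_runs {s : State} (hs : Consts r I ε N s) {c : ℕ} (hc : s.var (r + 15) = c)
    {q : Fin n → ℕ} (hq : ∀ i : Fin n, s.arr (r + 20) i = q i) {x : Finset (Fin n)}
    (hx : StoresSolution (s.arr 2) 0 x) :
    Runs (collectProg r) s (100 * (n + 1)) fun s' =>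
      (∀ y, y ≠ r + 20 → s'.var y = s.var y) ∧ (∀ y, y ≠ r + 14 → s'.arr y = s.arr y) ∧
      (∀ m, m < c * n → s'.arr (r + 14) m = s.arr (r + 14) m) ∧
      StoresSolution (s'.arr (r + 14)) (c * n) (x.filter fun i => 0 < q i) := by
  let Inv : ℕ → State → Prop := fun j s' => s'.var (r + 20) = j ∧
      (∀ y, y ≠ r + 20 → s'.var y = s.var y) ∧ (∀ y, y ≠ r + 14 → s'.arr y = s.arr y) ∧
      (∀ m, m < c * n → s'.arr (r + 14) m = s.arr (r + 14) m) ∧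
      ∀ i : Fin n, (i : ℕ) < j → s'.arr (r + 14) (c * n + i) =
        if i ∈ x.filter fun i => 0 < q i then 1 else 0
  have init : Runs (.assign (r + 20) (.const 0)) s 2 (Inv 0) := by
    refine Prog.runs_of_pre _ (by simp [Prog.size, Expr.cost]) ?_
    simp only [Prog.pre, Expr.eval, Inv]
    exact ⟨by simp, fun y hy => by simp [hy], by simp, by simp, by simp⟩
  have loop : ∀ s', Inv 0 s' → Runs (.whileLt (.var (r + 20)) (.var (r + 10)) (collectItemProg r))
      s' (n * (1 + 2 + 40) + (1 + 2)) (Inv n) := by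
    intro s' hs'
    have card : ∀ s₁ : State, (∀ y, y ≠ r + 20 → s₁.var y = s.var y) → s₁.var (r + 10) = n :=
      fun s₁ h => by rw [h _ (by omega), hs.card]
    refine Runs.count (f := .var (r + 10)) (fun j s₁ h => ⟨h.1, card s₁ h.2.1⟩)
      (fun j s₁ hj h => ?_) hs'
    obtain ⟨hi, hv, ha, hold, hnew⟩ := h
    have hn := card s₁ hv
    have h15 : s₁.var (r + 15) = c := by rw [hv _ (by omega), hc]
    have hqj : s₁.arr (r + 20) j = q ⟨j, hj⟩ := by rw [ha _ (by omega)]; exact hq ⟨j, hj⟩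
    have hxj : s₁.arr 2 j = if (⟨j, hj⟩ : Fin n) ∈ x then 1 else 0 := by
      rw [ha _ (by omega), ← hx ⟨j, hj⟩, zero_add]
    have hadr : ⌊(c : ℚ) * n + j⌋₊ = c * n + j := by
      have : (c : ℚ) * n + j = ((c * n + j : ℕ) : ℚ) := by push_cast; rfl
      rw [this, Nat.floor_natCast]
    have step : ∀ v : ℚ, v = (if (⟨j, hj⟩ : Fin n) ∈ x.filter (fun i => 0 < q i) then 1 else 0) →
        Inv (j + 1) ((s₁.setCell (r + 14) (c * n + j) v).setVar (r + 20) (j + 1)) := by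
      intro v hvv
      refine ⟨by simp, fun y hy => by simp [hy, hv y hy], fun y hy => ?_, fun m hm => ?_,
        fun i hij => ?_⟩
      · simp [State.setCell_arr, hy, ha y hy]
      · have : m ≠ c * n + j := by omega
        simp [this, hold m hm]
      · by_cases hij' : (i : ℕ) = j
        · have : i = ⟨j, hj⟩ := Fin.ext hij'
          subst this
          simp [hvv]
        · have := hnew i (by omega)
          simp only [State.setVar_arr, State.setCell_arr_same]
          rw [Function.update_of_ne (by omega), this]
    refine Prog.runs_of_pre _ (by simp [collectItemProg, Prog.size, Expr.cost]) ?_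
    simp only [collectItemProg, Prog.pre, Expr.eval]
    simp only [State.setCell_var, hi, hn, h15, Nat.floor_natCast, hqj, hadr, Nat.cast_pos]
    refine ⟨fun hpos => step _ ?_, fun hpos => step _ ?_⟩
    · simp [hxj, hpos]
    · simp [hpos]
  refine (init.seq loop).mono (by omega) ?_
  rintro s' ⟨-, hv, ha, hold, hnew⟩
  exact ⟨hv, ha, hold, fun i => hnew i i.2⟩

/-! ### The sweep and its invariant. -/

variable (r I ε N) in
/-- The state of the sweep after `c` breakpoints have been found. -/
structure Sweeping (c : ℕ) (s : State) : Prop where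
  consts : Consts r I ε N s
  count : s.var (r + 15) = c
  active : s.var (r + 17) = 1
  generic : Generic (coeffBound I.intercept I.slope N) (s.var (r + 16))
  dominates : Dominates (coeffBound I.intercept I.slope N) (s.var (r + 16))
    {t | (∀ i, i + 1 = c → (s.arr (r + 13) i : ℝ) ≤ t) ∧ t ≤ s.var (r + 16)}
  chain : ∃ τ : ℕ → ℚ, τ c = s.var (r + 16) ∧ ∀ j < c, τ j < τ (j + 1) ∧
    Separated I.intercept I.slope N (τ j) (τ (j + 1))
  last : ∀ i, i + 1 = c → s.arr (r + 13) i < s.var (r + 16)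
  sorted : ∀ i j, i < j → j < c → s.arr (r + 13) i < s.arr (r + 13) j
  solved : ∀ j < c, ∃ x : Finset (Fin n), StoresSolution (s.arr (r + 14)) (j * n) x ∧
    ∀ t : ℝ, (∀ i, i + 1 = j → (s.arr (r + 13) i : ℝ) ≤ t) → t ≤ s.arr (r + 13) j →
      I.IsApprox ε (I.profitAt t) x

variable (r I ε N) in
/-- The result of the sweep with `c` breakpoints. -/
structure Swept (c : ℕ) (s : State) : Prop where
  card : s.var (r + 10) = n
  count : s.var (r + 15) = c
  le : c ≤ n * (N * 2)
  sorted : ∀ i j, i < j → j < c → s.arr (r + 13) i < s.arr (r + 13) j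
  solved : ∀ j ≤ c, ∃ x : Finset (Fin n), StoresSolution (s.arr (r + 14)) (j * n) x ∧
    ∀ t ∈ piece c (s.arr (r + 13)) j, I.IsApprox ε (I.profitAt t) x

theorem Sweeping.le {c : ℕ} {s : State} (h : Sweeping r I ε N c s) : c ≤ n * (N * 2) := by
  obtain ⟨τ, -, hτ⟩ := h.chain
  exact card_separated_le (fun j hj => (hτ j hj).1) (fun j hj => (hτ j hj).2)

theorem StoresSolution.congr {u u' : ℕ → ℚ} {m : ℕ} {x : Finset (Fin n)}
    (h : StoresSolution u m x) (hu : ∀ i : Fin n, u' (m + i) = u (m + i)) :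
    StoresSolution u' m x := fun i => (hu i).trans (h i)

/-- The part of a step that follows the computation of the new solution. -/
theorem advance_runs (hN : 0 < N) (hnN : 2 * (n : ℝ) ≤ ε * N) (h₀ : 0 < ε) (h₁ : ε < 1)
    {c : ℕ} {s s₁ : State} (hs : Sweeping r I ε N c s) {aM bM : ℤ}
    (htop : IsTop I.intercept I.slope (s.var (r + 16)) aM bM)
    (hv : ∀ y, r + 10 ≤ y → y < r + 20 → s₁.var y = s.var y)
    (ha : ∀ y, r + 10 ≤ y → y < r + 14 → s₁.arr y = s.arr y)
    (hrate : IsRate I.intercept I.slope N (s.var (r + 16)) aM bM n (s₁.var (r + 24)))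
    (hold : ∀ m, m < c * n → s₁.arr (r + 14) m = s.arr (r + 14) m)
    {x : Finset (Fin n)} (hx : I.IsApprox ((ε : ℝ) / 2)
      (fun i => (level I.intercept I.slope N (s.var (r + 16)) aM bM i : ℝ)) x)
    (hnew : StoresSolution (s₁.arr (r + 14)) (c * n)
      (x.filter fun i => 0 < level I.intercept I.slope N (s.var (r + 16)) aM bM i)) :
    Runs (advanceProg r) s₁ 50 fun s' => Sweeping r I ε N (c + 1) s' ∨
      ¬ (Expr.const 0).eval s' < (Expr.var (r + 17)).eval s' ∧ ∃ c, Swept r I ε N c s' := by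
  have hc := hs.consts.congr (fun y h h' => hv y h (by omega)) fun y h h' => ha y h (by omega)
  have h15 : s₁.var (r + 15) = c := by rw [hv _ (by omega) (by omega), hs.count]
  have h16 : s₁.var (r + 16) = s.var (r + 16) := hv _ (by omega) (by omega)
  have h13 : s₁.arr (r + 13) = s.arr (r + 13) := ha _ (by omega) (by omega)
  set σ := s.var (r + 16) with hσ
  set ρ := s₁.var (r + 24) with hρ
  set H := coeffBound I.intercept I.slope N with hH
  have hε0 : (0 : ℝ) < ε := by exact_mod_cast h₀
  have hε1 : (ε : ℝ) < 1 := by exact_mod_cast h₁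
  have hsolved : ∀ j < c, ∃ x : Finset (Fin n), StoresSolution (s₁.arr (r + 14)) (j * n) x ∧
      ∀ t : ℝ, (∀ i, i + 1 = j → (s.arr (r + 13) i : ℝ) ≤ t) → t ≤ s.arr (r + 13) j →
        I.IsApprox ε (I.profitAt t) x := by
    intro j hj
    obtain ⟨y, hy, hy'⟩ := hs.solved j hj
    refine ⟨y, hy.congr fun i => hold _ ?_, hy'⟩
    have := Nat.mul_le_mul_right n (Nat.succ_le_of_lt hj)
    rw [Nat.succ_mul] at this
    omega
  have happrox : ∀ t : ℝ, (∀ i, i + 1 = c → (s.arr (r + 13) i : ℝ) ≤ t) →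
      (σ ≤ t → ∀ α β, IsEvent I.intercept I.slope N σ aM bM n α β → 0 ≤ (α : ℝ) + t * β) →
      I.IsApprox ε (I.profitAt t)
        (x.filter fun i => 0 < level I.intercept I.slope N σ aM bM i) := by
    intro t ht hright
    refine htop.isApprox hN hε0 hε1 hnN (fun α β he => ?_) hx
    -- The interval of a solution extends to both sides of the sample point σ: on the left the
    -- events are nonnegative by domination, on the right until the next event.
    obtain h | h := le_total (σ : ℝ) t
    · exact hright h α β he
    · exact hs.dominates α β (he.abs_le hN htop).1 (he.abs_le hN htop).2 (he.nonneg htop) t ⟨ht, h⟩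
  refine Prog.runs_of_pre _ (by simp [advanceProg, Prog.size, Expr.cost]) ?_
  simp only [advanceProg, Prog.pre, Expr.eval]
  refine ⟨fun hpos => Or.inl ?_, fun hneg => Or.inr ⟨?_, c, ?_⟩⟩
  · obtain ⟨α₀, β₀, he₀, hβ₀, hroot⟩ := hrate.exists_root hN htop hs.generic hpos
    have hb₀ := (he₀.abs_le hN htop).2
    set l := σ + 1 / ρ with hl
    have hlσ : σ < l := by
      have : 0 < 1 / ρ := by positivity
      linarith
    have hHpos : 0 < H := (abs_pos.2 hβ₀.ne).trans_le hb₀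
    have hHQ : (0 : ℚ) < H := by exact_mod_cast hHpos
    have hstep : (0 : ℚ) < 1 / (2 * H ^ 2) := by positivity
    have e16 : (1 : ℚ) / (2 * (H * H)) = 1 / (2 * H ^ 2) := by rw [sq]
    have hcell : ∀ i, i ≠ c → Function.update (s.arr (r + 13)) c l i = s.arr (r + 13) i :=
      fun i hi => Function.update_of_ne hi _ _
    simp only [State.setVar_var, State.setCell_var, Nat.add_left_cancel_iff,
      Nat.reduceEqDiff, if_false, h15, h16, Nat.floor_natCast, hc.bound, ← hρ, ← hl, ← hH, e16]
    refine ⟨hc.congr (fun y h h' => ?_) fun y h h' => ?_, ?_, ?_, ?_, ?_, ?_, ?_, ?_, ?_⟩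
    · have h1 : y ≠ r + 15 := by omega
      have h2 : y ≠ r + 16 := by omega
      simp [h1, h2]
    · have h1 : y ≠ r + 13 := by omega
      simp [State.setCell_arr, h1]
    · simp
    · simp [hv (r + 17) (by omega) (by omega), hs.active]
    · simpa using generic_next hb₀ hβ₀.ne hroot
    · have := dominates_next hb₀ hβ₀.ne hroot
      simpa [h13] using this
    · obtain ⟨τ, hτ, hτ'⟩ := hs.chain
      -- The chain of sample points is extended by the new one; the event with root `l` has negative
      -- slope, so it is negative there and separates it from σ.
      refine ⟨Function.update τ (c + 1) (l + 1 / (2 * H ^ 2)), by simp, fun j hj => ?_⟩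
      obtain hlt | rfl := (Nat.lt_succ_iff.1 hj).lt_or_eq
      · have h1 : j ≠ c + 1 := by omega
        have h2 : j + 1 ≠ c + 1 := by omega
        rw [Function.update_of_ne h1, Function.update_of_ne h2]
        exact hτ' j hlt
      · rw [Function.update_of_ne (by omega), Function.update_self, hτ]
        refine ⟨by linarith, he₀.separated hN htop hs.generic hβ₀.ne ?_⟩
        have : (β₀ : ℚ) < 0 := by exact_mod_cast hβ₀
        nlinarith
    · intro i hi
      obtain rfl : i = c := by omega
      simpa [h13] using hstep
    · intro i j hij hj
      simp only [State.setVar_arr, State.setCell_arr_same, h13]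
      rw [hcell i (by omega)]
      obtain hlt | rfl := (Nat.lt_succ_iff.1 hj).lt_or_eq
      · rw [hcell j (by omega)]
        exact hs.sorted i j hij hlt
      · rw [Function.update_self]
        obtain hlt | heq := (Nat.succ_le_of_lt hij).lt_or_eq
        · have h1 := hs.sorted i (j - 1) (by omega) (by omega)
          have h2 := hs.last (j - 1) (by omega)
          linarith
        · exact (hs.last i heq).trans hlσ
    · intro j hj
      have e14 : (r + 14 = r + 13) = False := by simp
      simp only [State.setVar_arr, State.setCell_arr, h13, e14, if_false, if_true]
      obtain hlt | rfl := (Nat.lt_succ_iff.1 hj).lt_or_eq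
      · obtain ⟨y, hy, hy'⟩ := hsolved j hlt
        refine ⟨y, hy, fun t ht ht' => hy' t (fun i hi => ?_) ?_⟩
        · have := ht i hi
          rwa [hcell i (by omega)] at this
        · rwa [hcell j (by omega)] at ht'
      · refine ⟨_, hnew, fun t ht ht' => happrox t (fun i hi => ?_) fun hσt α β he => ?_⟩
        · have := ht i hi
          rwa [hcell i (by omega)] at this
        · rw [Function.update_self] at ht'
          exact hrate.nonneg_of_pos hN htop hs.generic hpos he hσt ht'
  · simp
  · have hρ0 : ρ = 0 := le_antisymm (not_lt.1 hneg) hrate.nonneg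
    rw [hρ0] at hrate
    refine ⟨?_, ?_, hs.le, ?_, fun j hj => ?_⟩
    · simp [hc.card]
    · simp [h15]
    · simpa [h13] using hs.sorted
    · simp only [State.setVar_arr, h13]
      obtain hlt | rfl := hj.lt_or_eq
      · obtain ⟨y, hy, hy'⟩ := hsolved j hlt
        exact ⟨y, hy, fun t ht => hy' t ht.1 (ht.2 hlt)⟩
      · exact ⟨_, hnew, fun t ht => happrox t ht.1 fun hσt α β he =>
          hrate.nonneg_of_zero hN htop hs.generic he hσt⟩

theorem step_runs {P : Prog} {A : ℕ → ℚ → ℝ} (hP : IsOrdinaryFPTAS P A)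
    (hr : P.writeBound ≤ r + 10) (hn : 1 ≤ n) (h₀ : 0 < ε) (h₁ : ε < 1) (hN : 0 < N)
    (hnN : 2 * (n : ℝ) ≤ ε * N) {c : ℕ} {s : State} (hs : Sweeping r I ε N c s) :
    Runs (stepProg r P) s (600 * (n + 1) + ⌊A n (ε / 2)⌋₊) fun s' =>
      Sweeping r I ε N (c + 1) s' ∨
      ¬ (Expr.const 0).eval s' < (Expr.var (r + 17)).eval s' ∧ ∃ c, Swept r I ε N c s' := by
  have hc := hs.consts
  refine Runs.mono (T := 100 * (n + 1) + (300 * (n + 1) + ((6 + ⌊A n (ε / 2)⌋₊) +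
    (100 * (n + 1) + 50)))) ?_ (by omega) fun _ => id
  refine (top_runs hc).seq fun s₁ ⟨hag₁, aM, bM, haM, hbM, htop⟩ => ?_
  have hc₁ := hc.agree hag₁
  refine (level_runs hc₁ haM hbM).seq fun s₂ ⟨hag₂, hq, hrate⟩ => ?_
  rw [(hag₁ (r + 16) (by omega) (by omega)).1] at hq hrate
  have hc₂ := hc₁.agree hag₂
  have hag := hag₁.trans hag₂
  refine (call_runs hP hr hn h₀ h₁ hc₂ fun i => ⟨(hq i).1, (hq i).2.1⟩).seq
    fun s₃ ⟨hfr, x, hx, hap⟩ => ?_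
  have hag₃ : Agree r s s₃ := fun y h h' =>
    ⟨(hfr y h).1.trans (hag y h h').1, (hfr y h).2.trans (hag y h h').2⟩
  refine (collect_runs (hc.agree hag₃) (c := c)
    (q := level I.intercept I.slope N (s.var (r + 16)) aM bM)
    ((hag₃ _ (by omega) (by omega)).1.trans hs.count)
    (fun i => by rw [(hfr _ (by omega)).2]; exact (hq i).2.2) hx).seq
    fun s₄ ⟨hv, ha, hold, hnew⟩ => ?_
  refine advance_runs hN hnN h₀ h₁ hs htop (fun y h h' => ?_) (fun y h h' => ?_) ?_ (fun m hm => ?_)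
    hap hnew
  · rw [hv y (by omega), (hag₃ y h h').1]
  · rw [ha y (by omega), (hag₃ y h (by omega)).2]
  · rw [hv _ (by omega), (hfr _ (by omega)).1]
    exact hrate
  · rw [hold m hm, (hag₃ _ (by omega) (by omega)).2]

theorem epilogue_runs {c : ℕ} {s : State} (hs : Swept r I ε N c s) :
    Runs (epilogueProg r) s (50 * (c + 1) * (n + 1)) fun s' =>
      OutputsParametric I ε c s' ∧ c ≤ n * (N * 2) := by
  let Inv₁ : ℕ → State → Prop := fun j s' => s'.var (r + 20) = j ∧ s'.var 3 = c ∧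
    (∀ y, r + 10 ≤ y → y < r + 20 → s'.var y = s.var y ∧ s'.arr y = s.arr y) ∧
    ∀ i < j, s'.arr 3 i = s.arr (r + 13) i
  let Inv₂ : ℕ → State → Prop := fun j s' => s'.var (r + 20) = j ∧ s'.var 3 = c ∧
    s'.var (r + 27) = ((c + 1) * n : ℕ) ∧ s'.arr (r + 14) = s.arr (r + 14) ∧
    (∀ i < c, s'.arr 3 i = s.arr (r + 13) i) ∧ ∀ i < j, s'.arr 4 i = s.arr (r + 14) i
  have init₁ : Runs (.seq (.assign 3 (.var (r + 15))) (.assign (r + 20) (.const 0))) s 4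
      (Inv₁ 0) := by
    refine Prog.runs_of_pre _ (by simp [Prog.size, Expr.cost]) ?_
    simp only [Prog.pre, Expr.eval, Inv₁]
    refine ⟨by simp, by simp [hs.count], fun y h h' => ?_, by simp⟩
    have h1 : y ≠ r + 20 := by omega
    have h2 : y ≠ 3 := by omega
    simp [h1, h2]
  have loop₁ : ∀ s', Inv₁ 0 s' → Runs (.whileLt (.var (r + 20)) (.var (r + 15))
      (outputPointProg r)) s' (c * (1 + 2 + 10) + (1 + 2)) (Inv₁ c) := by
    intro s' hs'
    refine Runs.count (f := .var (r + 15))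
      (fun j s₁ h => ⟨h.1, ((h.2.2.1 _ (by omega) (by omega)).1.trans hs.count)⟩)
      (fun j s₁ hj h => ?_) hs'
    obtain ⟨hi, h3, hfr, hcop⟩ := h
    refine Prog.runs_of_pre _ (by simp [outputPointProg, Prog.size, Expr.cost]) ?_
    simp only [outputPointProg, Prog.pre, Expr.eval, Inv₁]
    refine ⟨by simp [hi], by simp [h3], fun y h h' => ?_, fun i hij => ?_⟩
    · have h1 : y ≠ r + 20 := by omega
      have h2 : y ≠ 3 := by omega
      simp [h1, h2, State.setCell_arr, hfr y h h']
    · simp only [State.setVar_arr, State.setCell_arr_same, hi, Nat.floor_natCast]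
      rw [(hfr (r + 13) (by omega) (by omega)).2]
      by_cases hij' : i = j
      · simp [hij']
      · rw [Function.update_of_ne hij', hcop i (by omega)]
  have init₂ : ∀ s', Inv₁ c s' → Runs (.seq (.assign (r + 27) (.mul (.add (.var (r + 15))
      (.const 1)) (.var (r + 10)))) (.assign (r + 20) (.const 0))) s' 10 (Inv₂ 0) := by
    rintro s' ⟨hi, h3, hfr, hcop⟩
    refine Prog.runs_of_pre _ (by simp [Prog.size, Expr.cost]) ?_
    simp only [Prog.pre, Expr.eval, Inv₂]
    have h10 : s'.var (r + 10) = n := (hfr _ (by omega) (by omega)).1.trans hs.card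
    have h15 : s'.var (r + 15) = c := (hfr _ (by omega) (by omega)).1.trans hs.count
    exact ⟨by simp, by simp [h3], by simp [h10, h15], by simp [hfr (r + 14) (by omega) (by omega)],
      by simpa using hcop, by simp⟩
  have loop₂ : ∀ s', Inv₂ 0 s' → Runs (.whileLt (.var (r + 20)) (.var (r + 27))
      (outputCellProg r)) s' ((c + 1) * n * (1 + 2 + 10) + (1 + 2)) (Inv₂ ((c + 1) * n)) := by
    intro s' hs'
    refine Runs.count (f := .var (r + 27)) (fun j s₁ h => ⟨h.1, h.2.2.1⟩)
      (fun j s₁ hj h => ?_) hs'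
    obtain ⟨hi, h3, h27, h14, hpts, hcop⟩ := h
    refine Prog.runs_of_pre _ (by simp [outputCellProg, Prog.size, Expr.cost]) ?_
    simp only [outputCellProg, Prog.pre, Expr.eval, Inv₂]
    refine ⟨by simp [hi], by simp [h3], by simpa using h27, by simp [State.setCell_arr, h14],
      by simpa [State.setCell_arr] using hpts, fun i hij => ?_⟩
    simp only [State.setVar_arr, State.setCell_arr_same, hi, Nat.floor_natCast, h14]
    by_cases hij' : i = j
    · simp [hij']
    · rw [Function.update_of_ne hij', hcop i (by omega)]
  refine (init₁.seq fun s₁ h₁ => (loop₁ s₁ h₁).seq fun s₂ h₂ => (init₂ s₂ h₂).seq loop₂).mono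
    (by nlinarith) ?_
  rintro s' ⟨-, h3, -, -, hpts, hcop⟩
  refine ⟨⟨h3, fun i j hij hj => ?_, fun j hj => ?_⟩, hs.le⟩
  · rw [hpts i (by omega), hpts j hj]
    exact hs.sorted i j hij hj
  · obtain ⟨x, hx, hap⟩ := hs.solved j hj
    refine ⟨x, hx.congr fun i => hcop _ ?_, fun t ht => hap t ⟨fun i hi => ?_, fun hjc => ?_⟩⟩
    · have := Nat.mul_le_mul_right n (Nat.succ_le_succ hj)
      rw [Nat.succ_mul] at this
      simp only [Nat.succ_eq_add_one] at this
      omega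
    · rw [← hpts i (by omega)]
      exact ht.1 i hi
    · rw [← hpts j hjc]
      exact ht.2 hjc

theorem sweep_runs {P : Prog} {A : ℕ → ℚ → ℝ} (hP : IsOrdinaryFPTAS P A)
    (hr : P.writeBound ≤ r + 10) (hn : 1 ≤ n) (h₀ : 0 < ε) (h₁ : ε < 1)
    (hN : (N : ℚ) = ⌊2 * (n : ℚ) / ε⌋ + 1) {s : State} (hs : LoadsParametric I ε s) :
    Runs (sweepProg r P) s
      ((2 * n * N + 1) * (1000 * (n + 1) + ⌊A n (ε / 2)⌋₊)) fun s' =>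
      ∃ c, OutputsParametric I ε c s' ∧ c ≤ n * (N * 2) := by
  have hle : 2 * (n : ℚ) / ε ≤ N := by rw [hN]; exact (Int.lt_floor_add_one _).le
  have hn' : (1 : ℚ) ≤ n := by exact_mod_cast hn
  have hN0 : 0 < N := by
    have : (0 : ℚ) < 2 * (n : ℚ) / ε := by positivity
    exact_mod_cast this.trans_le hle
  have hnN : 2 * (n : ℝ) ≤ ε * N := by
    rw [div_le_iff₀ h₀, mul_comm (N : ℚ)] at hle
    exact_mod_cast hle
  set M := n * (N * 2) with hM
  set T := 600 * (n + 1) + ⌊A n (ε / 2)⌋₊ with hT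
  have loop : ∀ s', Sweeping r I ε N 0 s' → Runs (.whileLt (.const 0) (.var (r + 17))
      (stepProg r P)) s' ((M + 1) * (1 + 1 + 1 + T) + (1 + 1 + 1))
      fun s' => ∃ c, Swept r I ε N c s' := by
    intro s' hs'
    -- The invariant itself forces c ≤ M, so the loop ends after at most M + 1 rounds.
    refine Runs.whileLt (Inv := fun c s => Sweeping r I ε N c s) (N := M + 1)
      (fun c s h => ⟨?_, Nat.lt_succ_of_le h.le⟩)
      (fun c s h => step_runs hP hr hn h₀ h₁ hN0 hnN h) (M + 1) 0 s' (by omega) (Or.inl hs')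
    simp [Expr.eval, h.active]
  have total : Runs (sweepProg r P) s (100 * (n + 1) + (((M + 1) * (1 + 1 + 1 + T) + (1 + 1 + 1)) +
      50 * (M + 1) * (n + 1))) fun s' =>
      ∃ c, OutputsParametric I ε c s' ∧ c ≤ n * (N * 2) := by
    refine (prologue_runs hs hN).seq fun s₁ ⟨hc, h16, h15, h17⟩ => ?_
    refine (loop s₁ ⟨hc, by simp [h15], h17, ?_, ?_, ⟨fun _ => s₁.var (r + 16), rfl, by simp⟩,
      by simp, by simp, by simp⟩).seq fun s₂ ⟨c, h⟩ => ?_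
    · rw [h16]
      exact generic_start
    · rw [h16]
      intro α β hα hβ h t ht
      exact dominates_start α β hα hβ h t (by simpa using ht)
    · have hcM := h.le
      refine (epilogue_runs h).mono ?_ fun s' h' => ⟨c, h'⟩
      gcongr
  refine total.mono ?_ fun _ => id
  have hM2 : 2 * n * N + 1 = M + 1 := by rw [hM]; ring
  rw [hM2, hT]
  have : 1 ≤ M + 1 := by omega
  nlinarith [Nat.zero_le (M * n), Nat.zero_le (M * ⌊A n (ε / 2)⌋₊)]

end Algorithm

/-! ### Assembling the bounds. -/

theorem exists_parametricFPTAS {P : Prog} {A : ℕ → ℚ → ℝ}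
    (hP : IsOrdinaryFPTAS P A) :
    ∃ Q : Prog, IsParametricFPTAS Q (fun n ε => 20000 * ((n : ℝ) ^ 2 / ε) * A n (ε / 2))
      (fun n ε => 20000 * ((n : ℝ) ^ 2 / ε)) := by
  refine ⟨sweepProg P.writeBound P, ?_, ?_⟩
  · obtain ⟨d, hd⟩ := hP.1
    -- One number has to serve as factor and as exponent; since n/ε ≥ 1, the exponent d + 2 may be
    -- raised to it.
    refine ⟨20000 * 2 ^ d * (d + 2), fun n ε hn h₀ h₁ => ?_⟩
    have hd' := hd n (ε / 2) hn (by linarith) (by linarith)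
    have hε0 : (0 : ℝ) < ε := by exact_mod_cast h₀
    have hε1 : (ε : ℝ) < 1 := by exact_mod_cast h₁
    have hn' : (1 : ℝ) ≤ n := by exact_mod_cast hn
    set y : ℝ := (n : ℝ) / ε with hy
    have hy1 : 1 ≤ y := by
      rw [hy, le_div_iff₀ hε0]
      linarith
    have h1 : (n : ℝ) ^ 2 / ε ≤ y ^ 2 := by
      rw [hy, div_pow]
      gcongr
      nlinarith
    have h2 : (n : ℝ) / ((ε / 2 : ℚ) : ℝ) = 2 * y := by
      rw [hy]
      push_cast
      field_simp
    rw [h2, mul_pow] at hd'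
    have hy0 : 0 ≤ y := by linarith
    calc 20000 * ((n : ℝ) ^ 2 / ε) * A n (ε / 2)
        ≤ 20000 * ((n : ℝ) ^ 2 / ε) * (d * (2 ^ d * y ^ d)) := by gcongr
      _ ≤ 20000 * y ^ 2 * (d * (2 ^ d * y ^ d)) := by gcongr
      _ = 20000 * 2 ^ d * d * y ^ (d + 2) := by ring
      _ ≤ 20000 * 2 ^ d * (d + 2) * y ^ (20000 * 2 ^ d * (d + 2)) := by
          have : 1 ≤ 20000 * 2 ^ d := by
            have := Nat.one_le_two_pow (n := d)
            omega
          gcongr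
          · linarith
          · exact Nat.le_mul_of_pos_left _ this
      _ = _ := by push_cast; ring
  · intro n I ε s hn h₀ h₁ hs
    have hε0 : (0 : ℝ) < ε := by exact_mod_cast h₀
    have hε1 : (ε : ℝ) < 1 := by exact_mod_cast h₁
    have hn' : (1 : ℝ) ≤ n := by exact_mod_cast hn
    set N := ⌊2 * (n : ℚ) / ε⌋₊ + 1 with hNdef
    have hq : (0 : ℚ) ≤ 2 * (n : ℚ) / ε := by positivity
    have hN : (N : ℚ) = ⌊2 * (n : ℚ) / ε⌋ + 1 := by
      rw [hNdef]
      push_cast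
      rw [← floor_max_zero, max_eq_left]
      exact_mod_cast Int.floor_nonneg.2 hq
    have hNle : (N : ℝ) ≤ 3 * (n / ε) := by
      have h1 : (N : ℚ) ≤ 2 * (n : ℚ) / ε + 1 := by
        rw [hNdef]
        push_cast
        linarith [Nat.floor_le hq]
      have h2 : (N : ℝ) ≤ 2 * (n : ℝ) / ε + 1 := by exact_mod_cast h1
      have h3 : 1 ≤ (n : ℝ) / ε := by
        rw [le_div_iff₀ hε0]
        linarith
      rw [mul_div_assoc] at h2
      linarith
    have hA := hP.le_time hn (half_pos h₀) (by linarith : ε / 2 < 1)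
    have hfloor := Nat.floor_le ((Nat.cast_nonneg n).trans hA)
    have hpieces : (2 * n * N + 1 : ℝ) ≤ 7 * (n ^ 2 / ε) := by
      have h1 : (n : ℝ) * N ≤ 3 * (n ^ 2 / ε) := by
        calc (n : ℝ) * N ≤ n * (3 * (n / ε)) := by gcongr
          _ = 3 * (n ^ 2 / ε) := by ring
      have h2 : 1 ≤ (n : ℝ) ^ 2 / ε := by
        rw [le_div_iff₀ hε0]
        nlinarith
      linarith
    obtain ⟨t, s', hex, ht, c, hout, hc⟩ := sweep_runs (r := P.writeBound) hP (by omega) hn h₀ h₁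
      hN hs
    refine ⟨t, s', c, hex, ?_, ?_, hout⟩
    -- The overhead 1000(n + 1) ≤ 2000n is at most 2000 A(n, ε/2), which leaves the constant 7 ·
    -- 2001 ≤ 20000.
    · calc (t : ℝ) ≤ ((2 * n * N + 1) * (1000 * (n + 1) + ⌊A n (ε / 2)⌋₊) : ℕ) := by
            exact_mod_cast ht
        _ = (2 * n * N + 1) * (1000 * (n + 1) + (⌊A n (ε / 2)⌋₊ : ℝ)) := by push_cast; ring
        _ ≤ (7 * (n ^ 2 / ε)) * (2001 * A n (ε / 2)) := by
            gcongr
            linarith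
        _ ≤ 20000 * ((n : ℝ) ^ 2 / ε) * A n (ε / 2) := by
            have h1 : 0 ≤ (n : ℝ) ^ 2 / ε * A n (ε / 2) :=
              mul_nonneg (by positivity) ((Nat.cast_nonneg n).trans hA)
            linarith
    · have h1 : (c : ℝ) ≤ n * (N * 2) := by exact_mod_cast hc
      have h2 : 0 ≤ (n : ℝ) ^ 2 / ε := by positivity
      linarith

end ParamKnapsack

theorem theorem3 :
    ∃ C : ℝ, 0 < C ∧
      ∀ (P : ParamKnapsack.Prog) (A : ℕ → ℚ → ℝ), ParamKnapsack.IsOrdinaryFPTAS P A →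
        ∃ (Q : ParamKnapsack.Prog) (B : ℕ → ℚ → ℝ),
          ParamKnapsack.IsParametricFPTAS Q B (fun n ε => C * ((n : ℝ) ^ 2 / ε)) ∧
          (∀ (n : ℕ) (ε : ℚ), 1 ≤ n → 0 < ε → ε < 1 →
            B n ε ≤ C * ((n : ℝ) ^ 2 / ε) * A n (ε / 2)) ∧
          (∀ K : ℝ,
            (∀ (n : ℕ) (ε : ℚ), 1 ≤ n → 0 < ε → ε < 1 → A n (ε / 2) ≤ K * A n ε) →
            ∀ (n : ℕ) (ε : ℚ), 1 ≤ n → 0 < ε → ε < 1 →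
              B n ε ≤ C * K * ((n : ℝ) ^ 2 / ε) * A n ε) ∧
          (∀ c : ℝ,
            (∀ (n : ℕ) (ε : ℚ), 1 ≤ n → 0 < ε → ε ≤ 1 / 2 →
              A n ε ≤ c * ((n : ℝ) * Real.log (1 / ε)
                + 1 / (ε : ℝ) ^ 3 * Real.log (1 / ε) ^ 2)) →
            ∃ C' : ℝ, ∀ (n : ℕ) (ε : ℚ), 1 ≤ n → 0 < ε → ε ≤ 1 / 2 →
              B n ε ≤ C' * ((n : ℝ) ^ 3 / ε * Real.log (1 / ε)
                + (n : ℝ) ^ 2 / (ε : ℝ) ^ 4 * Real.log (1 / ε) ^ 2)) := by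
  refine ⟨20000, by norm_num, fun P A hP => ?_⟩
  obtain ⟨Q, hQ⟩ := ParamKnapsack.exists_parametricFPTAS hP
  refine ⟨Q, _, hQ, fun n ε _ _ _ => le_rfl, fun K hK n ε hn h₀ h₁ => ?_, fun c hc => ?_⟩
  · have hε0 : (0 : ℝ) < ε := by exact_mod_cast h₀
    calc 20000 * ((n : ℝ) ^ 2 / ε) * A n (ε / 2) ≤ 20000 * ((n : ℝ) ^ 2 / ε) * (K * A n ε) := by
          gcongr
          exact hK n ε hn h₀ h₁
      _ = _ := by ring
  -- Halving ε multiplies 1/ε³ by 8 and, as ε ≤ 1/2, at most doubles the logarithm, so its square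
  -- grows by at most 4; this gives 32. The sign of `c` is not prescribed, hence the absolute value.
  · refine ⟨20000 * 32 * |c|, fun n ε hn h₀ h₁ => ?_⟩
    have hε0 : (0 : ℝ) < ε := by exact_mod_cast h₀
    have hε1 : (ε : ℝ) ≤ 1 / 2 := by
      have : (ε : ℝ) ≤ ((1 / 2 : ℚ) : ℝ) := by exact_mod_cast h₁
      push_cast at this
      exact this
    have hA := hc n (ε / 2) hn (by linarith) (by linarith)
    have hcast : ((ε / 2 : ℚ) : ℝ) = (ε : ℝ) / 2 := by push_cast; rfl
    rw [hcast] at hA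
    set L := Real.log (1 / (ε : ℝ)) with hL
    have hL2 : Real.log 2 ≤ L := by
      apply Real.log_le_log (by norm_num)
      rw [le_div_iff₀ hε0]
      linarith
    have hL0 : 0 ≤ L := (Real.log_nonneg (by norm_num)).trans hL2
    have hlog : Real.log (1 / ((ε : ℝ) / 2)) = Real.log 2 + L := by
      rw [hL, ← Real.log_mul (by norm_num) (by positivity)]
      congr 1
      field_simp
    have hlog0 : 0 ≤ Real.log (1 / ((ε : ℝ) / 2)) := by
      rw [hlog]
      exact add_nonneg (Real.log_nonneg (by norm_num)) hL0
    have hlog2 : Real.log (1 / ((ε : ℝ) / 2)) ≤ 2 * L := by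
      rw [hlog]
      linarith
    have hA' : A n (ε / 2) ≤ 32 * |c| * ((n : ℝ) * L + 1 / (ε : ℝ) ^ 3 * L ^ 2) := by
      calc A n (ε / 2) ≤ |c| * ((n : ℝ) * Real.log (1 / ((ε : ℝ) / 2))
            + 1 / ((ε : ℝ) / 2) ^ 3 * Real.log (1 / ((ε : ℝ) / 2)) ^ 2) :=
            hA.trans (mul_le_mul_of_nonneg_right (le_abs_self c) (by positivity))
        _ ≤ |c| * ((n : ℝ) * (2 * L) + 1 / ((ε : ℝ) / 2) ^ 3 * (2 * L) ^ 2) := by gcongr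
        _ = |c| * (2 * (n * L) + 32 * (1 / (ε : ℝ) ^ 3 * L ^ 2)) := by
            congr 1
            field_simp
            ring
        _ ≤ |c| * (32 * (n * L) + 32 * (1 / (ε : ℝ) ^ 3 * L ^ 2)) := by
            gcongr
            norm_num
        _ = _ := by ring
    calc 20000 * ((n : ℝ) ^ 2 / ε) * A n (ε / 2)
        ≤ 20000 * ((n : ℝ) ^ 2 / ε) * (32 * |c| * ((n : ℝ) * L + 1 / (ε : ℝ) ^ 3 * L ^ 2)) := by
          gcongr
      _ = _ := by
          field_simp
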